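/- An $n\times n\times n$ magic cube with magic sum $s$ is an array $(x_{i,j,k})_{1\le i,j,k\le n}$ of nonnegative integers such that the entries on every line parallel to a coordinate axis sum to $s$, and the entries on each of the $4$ main diagonals $\{(k,k,k)\}$, $\{(n+1-k,k,k)\}$, $\{(k,n+1-k,k)\}$, $\{(k,k,n+1-k)\}$ (where $k=1,\dots,n$) sum to $s$. Let $MC_n(s)$ be the number of $n\times n\times n$ magic cubes with magic sum $s$. A function $f:\mathbb{N}\to\mathbb{C}$ (where $0\in\mathbb{N}$) is a quasipolynomial of degree $D$ if there are an integer $N>0$ and polynomials $f_0,\dots,f_{N-1}$ such that $f(m)=f_i(m)$ whenever $m\equiv i \pmod N$, and the largest of the degrees of the $f_i$ is $D$. **Theorem 0.2.** 1. For every $n\ge 3$ with $n\ne 4$, the function $s\mapsto MC_n(s)$ is a quasipolynomial of degree $(n-1)^3-4$. The function $s\mapsto MC_4(s)$ is a quasipolynomial of degree $(4-1)^3-3=24$. 2. As formal power series, $$\sum_{s=0}^{\infty} MC_3(s)t^s=\frac{t^{12}+14t^9+36t^6+14t^3+1}{(1-t^3)^5}=1+19t^3+121t^6+439t^9+1171t^{12}+2581t^{15}+4999t^{18}+\cdots.$$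 Equivalently, $$MC_3(s)=\begin{cases}\frac{11}{324}s^4+\frac{11}{54}s^3+\frac{25}{36}s^2+\frac{7}{6}s+1 & \text{if } 3\mid s,\\ 0 & \text{otherwise.}\end{cases}$$ 3. The polytope of stochastic $3\times3\times3\times3$ magic hypercubes, i.e. the set of all $3\times3\times3\times3$ arrays of nonnegative real numbers whose sums along all lines parallel to a coordinate axis and along all $8$ main diagonals (the images of $\{(k,k,k,k): k=1,2,3\}$ under the symmetries of the $4$-cube) equal $1$, is not integral: it has a vertex with a non-integer coordinate. -/

import Mathlib

/-- A `d`-dimensional `n × ⋯ × n` array `x` all of whose sums along lines parallel to a coordinate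
axis equal `s`. The line through the cell `p` in direction `a` is obtained from `p` by letting the
`a`-th coordinate run through all its values. -/
def HasAxialSums {R : Type*} [AddCommMonoid R] {d n : ℕ}
    (x : (Fin d → Fin n) → R) (s : R) : Prop :=
  ∀ (a : Fin d) (p : Fin d → Fin n), ∑ k : Fin n, x (Function.update p a k) = s

/-- All main diagonals of `x` sum to `s`. A main diagonal is an image of the diagonal
`(k, …, k)` under the symmetries of the cube: the coordinates `a` with `ε a = true` are reversed
(`Fin.rev` is the map `k ↦ n + 1 - k` in 1-based numbering). Complementary choices of `ε` give the
same diagonal traversed backwards, so this is a condition on `2 ^ (d - 1)` diagonals. -/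
def HasDiagonalSums {R : Type*} [AddCommMonoid R] {d n : ℕ}
    (x : (Fin d → Fin n) → R) (s : R) : Prop :=
  ∀ ε : Fin d → Bool, ∑ k : Fin n, x (fun a => if ε a then Fin.rev k else k) = s

/-- The set of `d`-dimensional magic `n × ⋯ × n` hypercubes with nonnegative integer entries and
magic sum `s`. -/
def magicHypercubes (d n s : ℕ) : Set ((Fin d → Fin n) → ℕ) :=
  {x | HasAxialSums x s ∧ HasDiagonalSums x s}

/-- There are only finitely many `n × n × n` magic cubes of given magic sum, so that counting them
by `Set.ncard` is meaningful. -/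
theorem magicHypercubes_three_finite (n s : ℕ) : (magicHypercubes 3 n s).Finite := by
  refine (Set.finite_Iic (fun _ : Fin 3 → Fin n => s)).subset ?_
  intro x hx p
  have h := hx.1 0 p
  have h2 := Finset.single_le_sum (f := fun k : Fin n => x (Function.update p 0 k))
    (fun _ _ => Nat.zero_le _) (Finset.mem_univ (p 0))
  simp only [Function.update_eq_self] at h2
  exact h2.trans h.le

/-- The number `MC_n(s)` of `n × n × n` magic cubes with nonnegative integer entries and magic
sum `s`. -/
noncomputable def MC (n s : ℕ) : ℕ :=
  (magicHypercubes 3 n s).ncard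

/-- `f` is a quasipolynomial of degree `D`: for some quasi-period `N > 0` there are polynomials
`p 0, …, p (N - 1)` with `f m = p i (m)` whenever `m ≡ i` modulo `N`, and the largest of their
degrees is `D`. (The `p i` are determined by `f` and `N`, and the largest degree does not depend
on `N`.) -/
def IsQuasipolynomialOfDegree (f : ℕ → ℂ) (D : ℕ) : Prop :=
  ∃ N : ℕ, 0 < N ∧ ∃ p : Fin N → Polynomial ℂ,
    (∀ (m : ℕ) (i : Fin N), m ≡ (i : ℕ) [MOD N] → f m = (p i).eval (m : ℂ)) ∧
    (∀ i, (p i).degree ≤ (D : WithBot ℕ)) ∧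
    (∃ i, (p i).degree = (D : WithBot ℕ))

/-- The polytope of stochastic magic `n × ⋯ × n` hypercubes of dimension `d`: the real nonnegative
arrays all of whose axial and main diagonal sums equal `1`. -/
def stochasticMagicPolytope (d n : ℕ) : Set ((Fin d → Fin n) → ℝ) :=
  {x | (∀ p, 0 ≤ x p) ∧ HasAxialSums x 1 ∧ HasDiagonalSums x 1}

/-- A polytope is integral if all coordinates of all its vertices (extreme points) are integers. -/
def IsIntegralPolytope {ι : Type*} (P : Set (ι → ℝ)) : Prop :=
  ∀ v ∈ Set.extremePoints ℝ P, ∀ i, ∃ z : ℤ, v i = (z : ℝ)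

/-!
Why the theorem is true.

*Quasi-polynomiality.* The magic cubes of sum `s` are the lattice points of the slice at height `s`
of a rational polyhedral cone. Summing the constant function `1` over the lattice points of the
slices, one coordinate at a time, stays within the functions that are piecewise quasi-polynomial
with respect to a finite arrangement of hyperplanes through `0` (`MagicCube.IsPiecewise.elim`):
on a chamber of a suitable arrangement, the bounds of the inner sum and all the breakpoints between
them keep their order, so the inner sum telescopes to values of antidifferences of
quasi-polynomials at integer parts of linear forms. The chambers are closed cones, so when only
`s` is left the half line `s ≥ 0` is one single chamber; this is what makes the quasi-polynomial
correct at `s = 0` as well (`MagicCube.exists_quasiPoly_ncard`). Equalities are treated as pairs of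
inequalities.

*Degree.* Let `D` be the dimension of the space of rational arrays whose axial and diagonal sums
vanish. A magic cube is determined by its sum and `D` of its entries, so there are at most
`(s + 1) ^ D` of them; adding integer combinations of `D` independent zero-sum arrays to a constant
cube gives at least `t ^ D` cubes of sum `k * t`. Hence the degree is `D`
(`MagicCube.isQuasipolynomialOfDegree_natLineSums`). The arrays with vanishing axial sums have
dimension `(n - 1) ^ 3`. That the four diagonal sums are independent on them is seen on tensors of
symmetric and antisymmetric vectors of zero sum. The one exception is `n = 4`, where every symmetric
vector of zero sum is a multiple of `(1, -1, -1, 1)`, whose cubes sum to zero; there the four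
diagonal sums add up to zero, and any three of them are independent.

*Side three.* The centre of a magic cube is a third `c` of its sum, and the cube is given by four
integers `z i` subject to conditions that are symmetric in the `z i`. For the sorted quadruple
they read `-c ≤ z 0`, `z 3 ≤ c` and `z 2 + z 3 - z 0 - z 1 ≤ c`. Counting the sorted quadruples
by their gaps, with multiplicities for the rearrangements, gives the polynomial
(`MagicCube.four_mul_MC_three`), and the generating function follows.

*Dimension four.* The centre of every stochastic magic `3 × 3 × 3 × 3` hypercube is `1 / 3`, and
the polytope has a vertex because it is compact and nonempty.
-/

namespace MagicCube

/-! ### Quasi-polynomials on abelian groups -/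

/-- Polynomial functions on an abelian group `V`: the algebra of functions `V → ℚ` generated by the
integer linear forms on `V`. No basis of `V` is chosen, so that `V` can be replaced by `V × ℤ` and
back without any bookkeeping of coordinates. -/
def polyFun (V : Type) [AddCommGroup V] : Subalgebra ℚ (V → ℚ) :=
  Algebra.adjoin ℚ (Set.range fun ℓ : V →+ ℤ => fun v => (ℓ v : ℚ))

/-- `f : V → ℚ` is a quasi-polynomial if it is a polynomial function on every coset of `N • V`, for
some `N > 0`. -/
def IsQuasiPoly {V : Type} [AddCommGroup V] (f : V → ℚ) : Prop :=
  ∃ N : ℕ, 0 < N ∧ ∀ r : V, (fun z => f (r + N • z)) ∈ polyFun V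

section

variable {V W : Type} [AddCommGroup V] [AddCommGroup W]

theorem form_mem_polyFun (ℓ : V →+ ℤ) : (fun v => (ℓ v : ℚ)) ∈ polyFun V :=
  Algebra.subset_adjoin ⟨ℓ, rfl⟩

theorem const_mem_polyFun (c : ℚ) : (fun _ : V => c) ∈ polyFun V :=
  (polyFun V).algebraMap_mem c

theorem polyFun_comp_affine {f : V → ℚ} (hf : f ∈ polyFun V) (r : V) (φ : W →+ V) :
    (fun w => f (r + φ w)) ∈ polyFun W := by
  induction hf using Algebra.adjoin_induction with
  | mem g hg =>
    obtain ⟨ℓ, rfl⟩ := hg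
    have h := (polyFun W).add_mem (const_mem_polyFun (V := W) (ℓ r : ℚ))
      (form_mem_polyFun (ℓ.comp φ))
    convert h using 1
    ext w
    simp
  | algebraMap c => exact const_mem_polyFun c
  | add f g _ _ hf hg => exact (polyFun W).add_mem hf hg
  | mul f g _ _ hf hg => exact (polyFun W).mul_mem hf hg

theorem sum_mem_polyFun {ι : Type*} (s : Finset ι) {F : ι → V → ℚ}
    (h : ∀ i ∈ s, F i ∈ polyFun V) : (fun v => ∑ i ∈ s, F i v) ∈ polyFun V := by
  have := (polyFun V).sum_mem h
  convert this using 1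
  ext v
  simp

/-- Polynomial functions on `V × ℤ` are polynomials in the last variable whose coefficients are
polynomial functions on `V`. -/
theorem exists_polynomial_of_mem_polyFun_prod {f : V × ℤ → ℚ} (hf : f ∈ polyFun (V × ℤ)) :
    ∃ P : Polynomial (polyFun V), ∀ v y,
      f (v, y) = (P.map ((Pi.evalRingHom (fun _ : V => ℚ) v).comp
        (polyFun V).val.toRingHom)).eval (y : ℚ) := by
  induction hf using Algebra.adjoin_induction with
  | mem g hg =>
    obtain ⟨ℓ, rfl⟩ := hg
    refine ⟨Polynomial.C ⟨_, form_mem_polyFun (ℓ.comp (AddMonoidHom.inl V ℤ))⟩ +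
      Polynomial.C ⟨_, const_mem_polyFun (ℓ (0, 1) : ℚ)⟩ * Polynomial.X, fun v y => ?_⟩
    have h : ℓ (v, y) = ℓ (v, 0) + ℓ (0, 1) * y := by
      have : ((v, y) : V × ℤ) = (v, 0) + y • (0, 1) := by simp
      rw [this, map_add, map_zsmul, smul_eq_mul, mul_comm]
    simp [h]
  | algebraMap c =>
    exact ⟨Polynomial.C ⟨_, const_mem_polyFun c⟩, fun v y => by simp⟩
  | add f g _ _ hf hg =>
    obtain ⟨P, hP⟩ := hf
    obtain ⟨Q, hQ⟩ := hg
    exact ⟨P + Q, fun v y => by simp [hP, hQ]⟩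
  | mul f g _ _ hf hg =>
    obtain ⟨P, hP⟩ := hf
    obtain ⟨Q, hQ⟩ := hg
    exact ⟨P * Q, fun v y => by simp [hP, hQ]⟩

/-- Polynomial functions have polynomial antidifferences, by Bernoulli polynomials. -/
theorem exists_polyFun_antidifference {f : V × ℤ → ℚ} (hf : f ∈ polyFun (V × ℤ)) :
    ∃ Q ∈ polyFun (V × ℤ), ∀ v y, Q (v, y) - Q (v, y - 1) = f (v, y) := by
  obtain ⟨P, hP⟩ := exists_polynomial_of_mem_polyFun_prod hf
  clear hf
  induction P using Polynomial.induction_on' generalizing f with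
  | add p q hp hq =>
    obtain ⟨Q₁, h₁, h₁'⟩ := hp (f := fun x => (p.map ((Pi.evalRingHom (fun _ : V => ℚ) x.1).comp
        (polyFun V).val.toRingHom)).eval (x.2 : ℚ)) (fun _ _ => rfl)
    obtain ⟨Q₂, h₂, h₂'⟩ := hq (f := fun x => (q.map ((Pi.evalRingHom (fun _ : V => ℚ) x.1).comp
        (polyFun V).val.toRingHom)).eval (x.2 : ℚ)) (fun _ _ => rfl)
    refine ⟨Q₁ + Q₂, (polyFun _).add_mem h₁ h₂, fun v y => ?_⟩
    have e₁ := h₁' v y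
    have e₂ := h₂' v y
    simp only [Pi.add_apply, hP, Polynomial.map_add, Polynomial.eval_add]
    simp only at e₁ e₂
    linarith
  | monomial k c =>
    -- `B (y + 1) - B y = (k + 1) y ^ k` for the Bernoulli polynomial `B` of degree `k + 1`
    let B := (Polynomial.bernoulli (k + 1)).comp (1 + Polynomial.X)
    have hB : (fun x : V × ℤ => B.eval (x.2 : ℚ)) ∈ polyFun (V × ℤ) := by
      have h := form_mem_polyFun (AddMonoidHom.snd V ℤ)
      have h2 := Polynomial.aeval_mem_adjoin_singleton ℚ (p := B)
        (fun v : V × ℤ => ((AddMonoidHom.snd V ℤ v : ℤ) : ℚ))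
      have h3 := Algebra.adjoin_le (S := polyFun (V × ℤ))
        (Set.singleton_subset_iff.2 h) h2
      convert h3 using 1
      ext x
      rw [Polynomial.aeval_def, Polynomial.eval₂_eq_sum_range, Finset.sum_apply,
        Polynomial.eval_eq_sum_range]
      simp
    have hc := polyFun_comp_affine c.2 0 (AddMonoidHom.fst V ℤ)
    refine ⟨_, (polyFun (V × ℤ)).smul_mem ((polyFun (V × ℤ)).mul_mem hc hB) ((k + 1 : ℚ)⁻¹), ?_⟩
    intro v y
    have hb := Polynomial.bernoulli_eval_one_add (k + 1) (y : ℚ)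
    have hk : (k + 1 : ℚ) ≠ 0 := by positivity
    simp only [hP, B, Pi.smul_apply, Pi.mul_apply, Polynomial.eval_comp, Polynomial.eval_add,
      Polynomial.eval_one, Polynomial.eval_X, Polynomial.map_monomial, Polynomial.eval_monomial,
      hb, smul_eq_mul]
    simp
    field_simp
    ring

/-- A function on `V × ℤ` is polynomial if it is so at `0` and its differences are. -/
theorem mem_polyFun_of_difference {F : V × ℤ → ℚ} (h0 : (fun v => F (v, 0)) ∈ polyFun V)
    (hd : (fun x : V × ℤ => F x - F (x.1, x.2 - 1)) ∈ polyFun (V × ℤ)) :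
    F ∈ polyFun (V × ℤ) := by
  obtain ⟨Q, hQ, hQd⟩ := exists_polyFun_antidifference hd
  have key : ∀ v (y : ℤ), F (v, y) = Q (v, y) + (F (v, 0) - Q (v, 0)) := by
    intro v y
    induction y using Int.induction_on with
    | zero => ring
    | succ i ih =>
      have := hQd v (i + 1)
      simp only [add_sub_cancel_right] at this
      linarith
    | pred i ih =>
      have := hQd v (-i)
      simp only at this
      linarith
  have h1 := polyFun_comp_affine h0 0 (AddMonoidHom.fst V ℤ)
  have h2 := polyFun_comp_affine hQ 0 ((AddMonoidHom.inl V ℤ).comp (AddMonoidHom.fst V ℤ))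
  have h3 := (polyFun (V × ℤ)).add_mem hQ ((polyFun (V × ℤ)).sub_mem h1 h2)
  convert h3 using 1
  ext ⟨v, y⟩
  simpa using key v y

theorem quasi_of_dvd {f : V → ℚ} {N M : ℕ} (h : ∀ r : V, (fun z => f (r + N • z)) ∈ polyFun V)
    (hNM : N ∣ M) : ∀ r : V, (fun z => f (r + M • z)) ∈ polyFun V := by
  obtain ⟨k, rfl⟩ := hNM
  intro r
  have := polyFun_comp_affine (h r) 0 (nsmulAddMonoidHom (α := V) k)
  simpa [mul_smul] using this

theorem IsQuasiPoly.add {f g : V → ℚ} (hf : IsQuasiPoly f) (hg : IsQuasiPoly g) :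
    IsQuasiPoly (fun v => f v + g v) := by
  obtain ⟨N, hN, h⟩ := hf
  obtain ⟨M, hM, h'⟩ := hg
  exact ⟨N * M, Nat.mul_pos hN hM, fun r => (polyFun V).add_mem
    (quasi_of_dvd h (dvd_mul_right _ _) r) (quasi_of_dvd h' (dvd_mul_left _ _) r)⟩

theorem IsQuasiPoly.neg {f : V → ℚ} (hf : IsQuasiPoly f) : IsQuasiPoly (fun v => -f v) := by
  obtain ⟨N, hN, h⟩ := hf
  exact ⟨N, hN, fun r => (polyFun V).neg_mem (h r)⟩

theorem IsQuasiPoly.sub {f g : V → ℚ} (hf : IsQuasiPoly f) (hg : IsQuasiPoly g) :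
    IsQuasiPoly (fun v => f v - g v) := by
  simpa [sub_eq_add_neg] using hf.add hg.neg

theorem IsQuasiPoly.const (c : ℚ) : IsQuasiPoly (fun _ : V => c) :=
  ⟨1, one_pos, fun _ => const_mem_polyFun c⟩

theorem IsQuasiPoly.comp {f : V → ℚ} (hf : IsQuasiPoly f) (φ : W →+ V) :
    IsQuasiPoly (fun w => f (φ w)) := by
  obtain ⟨N, hN, h⟩ := hf
  refine ⟨N, hN, fun r => ?_⟩
  have := polyFun_comp_affine (h (φ r)) 0 φ
  simpa using this

/-- Quasi-polynomials have quasi-polynomial antidifferences. -/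
theorem IsQuasiPoly.exists_antidifference {f : V × ℤ → ℚ} (hf : IsQuasiPoly f) :
    ∃ Q : V × ℤ → ℚ, IsQuasiPoly Q ∧ ∀ v y, Q (v, y) - Q (v, y - 1) = f (v, y) := by
  obtain ⟨N, hN, h⟩ := hf
  let Q : V × ℤ → ℚ := fun x =>
    ∑ j ∈ Finset.Ioc 0 x.2, f (x.1, j) - ∑ j ∈ Finset.Ioc x.2 0, f (x.1, j)
  have hQ : ∀ v y, Q (v, y) - Q (v, y - 1) = f (v, y) := by
    intro v y
    rcases le_or_gt y 0 with hy | hy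
    · have h1 : Finset.Ioc (y - 1) 0 = insert y (Finset.Ioc y 0) := by
        ext j
        simp only [Finset.mem_Ioc, Finset.mem_insert]
        omega
      simp only [Q, h1]
      rw [Finset.sum_insert (by simp), Finset.Ioc_eq_empty (by omega : ¬ 0 < y),
        Finset.Ioc_eq_empty (by omega : ¬ 0 < y - 1)]
      simp
    · have h1 : Finset.Ioc 0 y = insert y (Finset.Ioc 0 (y - 1)) := by
        ext j
        simp only [Finset.mem_Ioc, Finset.mem_insert]
        omega
      simp only [Q, h1]
      rw [Finset.sum_insert (by simp), Finset.Ioc_eq_empty (by omega : ¬ y < 0),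
        Finset.Ioc_eq_empty (by omega : ¬ y - 1 < 0)]
      simp
  have hslice : ∀ (r : V) (j : ℤ), (fun z => f (r + N • z, j)) ∈ polyFun V := by
    intro r j
    have := polyFun_comp_affine (h (r, j)) 0 (AddMonoidHom.inl V ℤ)
    simpa using this
  refine ⟨Q, ⟨N, hN, ?_⟩, hQ⟩
  rintro ⟨r, t⟩
  refine mem_polyFun_of_difference ?_ ?_
  · have := (polyFun V).sub_mem (sum_mem_polyFun (Finset.Ioc 0 t) fun j _ => hslice r j)
      (sum_mem_polyFun (Finset.Ioc t 0) fun j _ => hslice r j)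
    convert this using 1
    ext z
    simp [Q]
  · have htel : ∀ (v : V) (y : ℤ) (n : ℕ),
        Q (v, y) - Q (v, y - n) = ∑ i ∈ Finset.range n, f (v, y - i) := by
      intro v y n
      induction n with
      | zero => simp
      | succ n ih =>
        rw [Finset.sum_range_succ, ← ih, ← hQ]
        push_cast
        rw [sub_sub y]
        ring
    have h2 := sum_mem_polyFun (Finset.range N) (fun i _ => h (r, t - i))
    convert h2 using 1
    ext ⟨z, y⟩
    have h3 := htel (r + N • z) (t + N * y) N
    simp only [Prod.smul_mk, Prod.mk_add_mk, nsmul_eq_mul]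
    have e1 : t + N * (y - 1) = t + N * y - N := by ring
    rw [e1, h3]
    refine Finset.sum_congr rfl fun i _ => ?_
    rw [show t + N * y - i = t - i + N * y by ring]

/-- Substituting for the last variable a function that is linear on cosets of `b • V`, such as the
integer part of a linear form divided by `b`. -/
theorem IsQuasiPoly.subst {Q : V × ℤ → ℚ} (hQ : IsQuasiPoly Q) (ρ : V → ℤ) {b : ℕ} (hb : 0 < b)
    (ℓ : V →+ ℤ) (hρ : ∀ v z, ρ (v + b • z) = ρ v + ℓ z) :
    IsQuasiPoly (fun v => Q (v, ρ v)) := by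
  obtain ⟨N, hN, h⟩ := hQ
  refine ⟨N * b, Nat.mul_pos hN hb, fun r => ?_⟩
  have := polyFun_comp_affine (h (r, ρ r)) 0 ((nsmulAddMonoidHom (α := V) b).prod ℓ)
  convert this using 1
  ext z
  have e : r + (N * b) • z = r + b • (N • z) := by rw [mul_comm, mul_smul]
  simp only [e, hρ]
  simp [smul_comm b N z]

theorem floor_div_add (ℓ : V →+ ℤ) {c : ℤ} (hc : c ≠ 0) (v z : V) :
    ⌊(ℓ (v + c.natAbs • z) : ℚ) / c⌋ = ⌊(ℓ v : ℚ) / c⌋ + (c.sign • ℓ) z := by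
  have hc' : (c : ℚ) ≠ 0 := by exact_mod_cast hc
  have h : (ℓ (v + c.natAbs • z) : ℚ) / c = (ℓ v : ℚ) / c + ((c.sign • ℓ) z : ℤ) := by
    have h2 : (c.natAbs : ℤ) = c * c.sign := by
      rw [mul_comm, Int.sign_mul_self_eq_natAbs]
    have h3 : ((c.natAbs : ℤ) : ℚ) = c * c.sign := by exact_mod_cast h2
    rw [map_add, map_nsmul]
    simp only [AddMonoidHom.smul_apply, smul_eq_mul, nsmul_eq_mul]
    rw [Int.cast_add, Int.cast_mul, Int.cast_mul, h3]
    field_simp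
  rw [h, Int.floor_add_intCast]

theorem IsQuasiPoly.subst_floor {Q : V × ℤ → ℚ} (hQ : IsQuasiPoly Q) (ℓ : V →+ ℤ) {c : ℤ}
    (hc : c ≠ 0) : IsQuasiPoly (fun v => Q (v, ⌊(ℓ v : ℚ) / c⌋)) :=
  hQ.subst _ (Int.natAbs_pos.2 hc) _ (floor_div_add ℓ hc)

theorem IsQuasiPoly.subst_ceil_sub_one {Q : V × ℤ → ℚ} (hQ : IsQuasiPoly Q) (ℓ : V →+ ℤ) {c : ℤ}
    (hc : c ≠ 0) : IsQuasiPoly (fun v => Q (v, ⌈(ℓ v : ℚ) / c⌉ - 1)) := by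
  refine hQ.subst (fun v => ⌈(ℓ v : ℚ) / c⌉ - 1) (Int.natAbs_pos.2 hc) (c.sign • ℓ) ?_
  intro v z
  have h := floor_div_add (-ℓ) hc v z
  simp only [AddMonoidHom.neg_apply, Int.cast_neg, neg_div, Int.floor_neg] at h
  simp only [AddMonoidHom.smul_apply, AddMonoidHom.neg_apply, smul_eq_mul] at h ⊢
  linarith

end

/-- Summing a quasi-polynomial over the last variable, by an antidifference `Q`. -/
theorem sum_Icc_of_antidifference {V : Type} {Q f : V × ℤ → ℚ}
    (h : ∀ v y, Q (v, y) - Q (v, y - 1) = f (v, y)) (v : V) {a b : ℤ} (hab : a ≤ b + 1) :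
    ∑ y ∈ Finset.Icc a b, f (v, y) = Q (v, b) - Q (v, a - 1) := by
  obtain ⟨n, hn⟩ : ∃ n : ℕ, b = a - 1 + n := ⟨(b - (a - 1)).toNat, by omega⟩
  subst hn
  induction n with
  | zero => simp
  | succ n ih =>
    have e : Finset.Icc a (a - 1 + ((n + 1 : ℕ) : ℤ)) =
        insert (a + n) (Finset.Icc a (a - 1 + (n : ℤ))) := by
      ext j
      simp only [Finset.mem_Icc, Finset.mem_insert]
      omega
    rw [e, Finset.sum_insert (by simp), ih (by omega), ← h]
    have e2 : a - 1 + ((n + 1 : ℕ) : ℤ) = a + n := by push_cast; ring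
    have e3 : a + (n : ℤ) - 1 = a - 1 + n := by ring
    rw [e2, e3]
    ring

/-! ### Piecewise quasi-polynomials and elimination of a variable -/

section

variable {V : Type} [AddCommGroup V]

/-- The points of `V` at which all forms in `B` are nonnegative: the lattice points of a rational
polyhedral cone. -/
def cone (B : Set (V →+ ℤ)) : AddSubmonoid V where
  carrier := {v | ∀ b ∈ B, 0 ≤ b v}
  zero_mem' := fun b _ => by simp
  add_mem' := fun {v w} hv hw b hb => by
    rw [map_add]
    exact add_nonneg (hv b hb) (hw b hb)

/-- The closed chamber of the arrangement of hyperplanes `A` on which the forms in `S` are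
nonnegative and the others nonpositive. -/
def chamber (A S : Set (V →+ ℤ)) : AddSubmonoid V where
  carrier := {v | ∀ a ∈ A, (a ∈ S → 0 ≤ a v) ∧ (a ∉ S → a v ≤ 0)}
  zero_mem' := fun a _ => by simp
  add_mem' := fun {v w} hv hw a ha => by
    rw [map_add]
    exact ⟨fun h => add_nonneg ((hv a ha).1 h) ((hw a ha).1 h),
      fun h => add_nonpos ((hv a ha).2 h) ((hw a ha).2 h)⟩

/-- `f` is piecewise quasi-polynomial on the cone of `B`: it agrees with a quasi-polynomial on every
chamber of some finite arrangement. The chambers are closed, so that all of these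
quasi-polynomials agree with `f` at the apex `0`. -/
def IsPiecewise (B : Set (V →+ ℤ)) (f : V → ℚ) : Prop :=
  ∃ A : Set (V →+ ℤ), A.Finite ∧ ∀ S : Set (V →+ ℤ), ∃ q : V → ℚ, IsQuasiPoly q ∧
    ∀ v ∈ cone B ⊓ chamber A S, f v = q v

/-- A submonoid on which finitely many forms have constant sign has a relatively interior point. -/
theorem exists_generic_point (C : AddSubmonoid V) {A : Set (V →+ ℤ)} (hA : A.Finite)
    (hs : ∀ a ∈ A, (∀ v ∈ C, 0 ≤ a v) ∨ (∀ v ∈ C, a v ≤ 0)) :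
    ∃ p ∈ C, ∀ a ∈ A, a p = 0 → ∀ v ∈ C, a v = 0 := by
  induction A, hA using Set.Finite.induction_on with
  | empty => exact ⟨0, C.zero_mem, by simp⟩
  | @insert a A _ _ ih =>
    obtain ⟨p, hp, h⟩ := ih fun b hb => hs b (Set.mem_insert_of_mem _ hb)
    by_cases ha : ∀ v ∈ C, a v = 0
    · refine ⟨p, hp, fun b hb hbp => ?_⟩
      rcases Set.mem_insert_iff.1 hb with rfl | hb
      · exact ha
      · exact h b hb hbp
    · push Not at ha
      obtain ⟨w, hw, haw⟩ := ha
      have key : ∀ b ∈ insert a A, b (p + w) = 0 → b p = 0 ∧ b w = 0 := by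
        intro b hb h0
        rw [map_add] at h0
        rcases hs b hb with h1 | h1
        · have := h1 p hp
          have := h1 w hw
          omega
        · have := h1 p hp
          have := h1 w hw
          omega
      refine ⟨p + w, C.add_mem hp hw, fun b hb hb0 => ?_⟩
      obtain ⟨hb1, hb2⟩ := key b hb hb0
      rcases Set.mem_insert_iff.1 hb with rfl | hb
      · exact absurd hb2 haw
      · exact h b hb hb1

/-- The coefficient of the last variable. -/
def lead (e : V × ℤ →+ ℤ) : ℤ := e (0, 1)

/-- The part of a form that does not involve the last variable. -/
def base (e : V × ℤ →+ ℤ) : V →+ ℤ := e.comp (AddMonoidHom.inl V ℤ)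

/-- The value of the last variable at which the form `e` vanishes above `v` (if `lead e ≠ 0`). -/
def root (e : V × ℤ →+ ℤ) (v : V) : ℚ := ((-base e) v : ℚ) / lead e

theorem apply_eq_base_add (e : V × ℤ →+ ℤ) (v : V) (y : ℤ) : e (v, y) = base e v + lead e * y := by
  have : ((v, y) : V × ℤ) = (v, 0) + y • (0, 1) := by simp
  rw [this, map_add, map_zsmul, smul_eq_mul, mul_comm]
  rfl

theorem apply_eq_lead_mul {e : V × ℤ →+ ℤ} (he : lead e ≠ 0) (v : V) (y : ℤ) :
    (e (v, y) : ℚ) = lead e * (y - root e v) := by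
  have : (lead e : ℚ) ≠ 0 := by exact_mod_cast he
  rw [apply_eq_base_add, root]
  push_cast
  field_simp
  simp [add_comm]

theorem nonneg_of_root_le {e : V × ℤ →+ ℤ} (he : 0 < lead e) {v : V} {y : ℤ}
    (h : root e v ≤ y) : 0 ≤ e (v, y) := by
  have h1 := apply_eq_lead_mul he.ne' v y
  have h2 : (0 : ℚ) < lead e := by exact_mod_cast he
  have : (0 : ℚ) ≤ e (v, y) := by
    rw [h1]
    exact mul_nonneg h2.le (by linarith)
  exact_mod_cast this

theorem nonpos_of_le_root {e : V × ℤ →+ ℤ} (he : 0 < lead e) {v : V} {y : ℤ}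
    (h : y ≤ root e v) : e (v, y) ≤ 0 := by
  have h1 := apply_eq_lead_mul he.ne' v y
  have h2 : (0 : ℚ) < lead e := by exact_mod_cast he
  have : (e (v, y) : ℚ) ≤ 0 := by
    rw [h1]
    exact mul_nonpos_of_nonneg_of_nonpos h2.le (by linarith)
  exact_mod_cast this

theorem nonpos_of_root_le {e : V × ℤ →+ ℤ} (he : lead e < 0) {v : V} {y : ℤ}
    (h : root e v ≤ y) : e (v, y) ≤ 0 := by
  have h1 := apply_eq_lead_mul he.ne v y
  have h2 : (lead e : ℚ) < 0 := by exact_mod_cast he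
  have : (e (v, y) : ℚ) ≤ 0 := by
    rw [h1]
    exact mul_nonpos_of_nonpos_of_nonneg h2.le (by linarith)
  exact_mod_cast this

theorem nonneg_of_le_root {e : V × ℤ →+ ℤ} (he : lead e < 0) {v : V} {y : ℤ}
    (h : y ≤ root e v) : 0 ≤ e (v, y) := by
  have h1 := apply_eq_lead_mul he.ne v y
  have h2 : (lead e : ℚ) < 0 := by exact_mod_cast he
  have : (0 : ℚ) ≤ e (v, y) := by
    rw [h1]
    exact mul_nonneg_of_nonpos_of_nonpos h2.le (by linarith)
  exact_mod_cast this

theorem root_le_of_nonneg {e : V × ℤ →+ ℤ} (he : 0 < lead e) {v : V} {y : ℤ}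
    (h : 0 ≤ e (v, y)) : root e v ≤ y := by
  have h1 := apply_eq_lead_mul he.ne' v y
  have h2 : (0 : ℚ) < lead e := by exact_mod_cast he
  have h3 : (0 : ℚ) ≤ e (v, y) := by exact_mod_cast h
  rw [h1] at h3
  linarith [nonneg_of_mul_nonneg_right h3 h2]

theorem le_root_of_nonneg {e : V × ℤ →+ ℤ} (he : lead e < 0) {v : V} {y : ℤ}
    (h : 0 ≤ e (v, y)) : y ≤ root e v := by
  have h1 := apply_eq_lead_mul he.ne v y
  have h2 : (lead e : ℚ) < 0 := by exact_mod_cast he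
  have h3 : (0 : ℚ) ≤ e (v, y) := by exact_mod_cast h
  rw [h1] at h3
  by_contra hlt
  push Not at hlt
  have := mul_neg_of_neg_of_pos h2 (by linarith : (0 : ℚ) < y - root e v)
  linarith

/-- The form on `V` that compares the roots of two forms on `V × ℤ`. -/
def resultant (e e' : V × ℤ →+ ℤ) : V →+ ℤ := lead e' • base e - lead e • base e'

theorem root_sub_root {e e' : V × ℤ →+ ℤ} (he : lead e ≠ 0) (he' : lead e' ≠ 0) (v : V) :
    root e' v - root e v = (resultant e e' v : ℚ) / (lead e * lead e') := by
  have h1 : (lead e : ℚ) ≠ 0 := by exact_mod_cast he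
  have h2 : (lead e' : ℚ) ≠ 0 := by exact_mod_cast he'
  simp only [root, resultant, AddMonoidHom.neg_apply, AddMonoidHom.sub_apply,
    AddMonoidHom.smul_apply, smul_eq_mul]
  push_cast
  field_simp
  ring

/-- Fourier–Motzkin elimination of the last variable. The forms are those that do not involve it,
and a comparison for each pair of a lower and an upper bound. They cut out the projection of the cone of
`B` over `ℚ`. -/
def fourierMotzkin (B : Set (V × ℤ →+ ℤ)) : Set (V →+ ℤ) :=
  base '' {b ∈ B | lead b = 0} ∪
    (fun e : (V × ℤ →+ ℤ) × (V × ℤ →+ ℤ) => -resultant e.1 e.2) ''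
      ({b ∈ B | 0 < lead b} ×ˢ {b ∈ B | lead b < 0})

theorem fourierMotzkin_finite {B : Set (V × ℤ →+ ℤ)} (hB : B.Finite) :
    (fourierMotzkin B).Finite :=
  ((hB.subset (Set.sep_subset _ _)).image _).union
    (((hB.subset (Set.sep_subset _ _)).prod (hB.subset (Set.sep_subset _ _))).image _)

theorem mem_cone_fourierMotzkin {B : Set (V × ℤ →+ ℤ)} {v : V} {y : ℤ} {k : ℕ} (hk : 0 < k)
    (h : (k • v, y) ∈ cone B) : v ∈ cone (fourierMotzkin B) := by
  have hk' : (0 : ℤ) < k := by exact_mod_cast hk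
  rintro b (⟨b, ⟨hb, hb0⟩, rfl⟩ | ⟨⟨e, e'⟩, ⟨⟨he, he0⟩, ⟨he', he0'⟩⟩, rfl⟩)
  · have := h b hb
    rw [apply_eq_base_add, hb0, map_nsmul, nsmul_eq_mul] at this
    exact nonneg_of_mul_nonneg_right (by linarith) hk'
  · have h1 := h e he
    have h2 := h e' he'
    rw [apply_eq_base_add, map_nsmul, nsmul_eq_mul] at h1 h2
    simp only [resultant, AddMonoidHom.neg_apply, AddMonoidHom.sub_apply,
      AddMonoidHom.smul_apply, smul_eq_mul]
    have h3 := mul_nonneg (neg_nonneg.2 he0'.le) h1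
    have h4 := mul_nonneg he0.le h2
    refine nonneg_of_mul_nonneg_right (a := (k : ℤ)) ?_ hk'
    linarith

/-- Summing a piecewise quasi-polynomial over the last variable gives a piecewise quasi-polynomial
on the Fourier–Motzkin projection. The chambers of the sum are those on which the roots of all
forms in the last variable keep their (weak) order. -/
theorem IsPiecewise.elim {B : Set (V × ℤ →+ ℤ)} (hB : B.Finite) {f : V × ℤ → ℚ}
    (hf : IsPiecewise B f) (s : V →+ ℤ) (h0 : AddMonoidHom.snd V ℤ ∈ B)
    (h1 : s.comp (AddMonoidHom.fst V ℤ) - AddMonoidHom.snd V ℤ ∈ B) :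
    IsPiecewise (fourierMotzkin B) (fun v => ∑ y ∈ Finset.Icc 0 (s v),
      open scoped Classical in if (v, y) ∈ cone B then f (v, y) else 0) := by
  classical
  obtain ⟨A, hA, hf⟩ := hf
  let E : Set (V × ℤ →+ ℤ) := {e ∈ A ∪ B | lead e ≠ 0}
  have hE : E.Finite := (hA.union hB).subset (Set.sep_subset _ _)
  let A' : Set (V →+ ℤ) := base '' A ∪
    (fun e : (V × ℤ →+ ℤ) × (V × ℤ →+ ℤ) => resultant e.1 e.2) '' (E ×ˢ E)
  refine ⟨A', (hA.image _).union ((hE.prod hE).image _), fun S => ?_⟩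
  set C := cone (fourierMotzkin B) ⊓ chamber A' S
  have hsign : ∀ a ∈ A', (∀ v ∈ C, 0 ≤ a v) ∨ (∀ v ∈ C, a v ≤ 0) := by
    intro a ha
    by_cases haS : a ∈ S
    · exact Or.inl fun v hv => (hv.2 a ha).1 haS
    · exact Or.inr fun v hv => (hv.2 a ha).2 haS
  obtain ⟨p, hp, hgen⟩ := exists_generic_point C ((hA.image _).union ((hE.prod hE).image _)) hsign
  have hsign_nonneg : ∀ a ∈ A', 0 ≤ a p → ∀ v ∈ C, 0 ≤ a v := by
    intro a ha hap v hv
    rcases hsign a ha with h | h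
    · exact h v hv
    · exact (hgen a ha (le_antisymm (h p hp) hap) v hv).ge
  have hsign_nonpos : ∀ a ∈ A', a p ≤ 0 → ∀ v ∈ C, a v ≤ 0 := by
    intro a ha hap v hv
    rcases hsign a ha with h | h
    · exact (hgen a ha (le_antisymm hap (h p hp)) v hv).le
    · exact h v hv
  -- the order of the roots at the generic point `p` is their weak order on the whole chamber
  have hord : ∀ e ∈ E, ∀ e' ∈ E, root e p ≤ root e' p → ∀ v ∈ C, root e v ≤ root e' v := by
    intro e he e' he' hle v hv
    have hmem : resultant e e' ∈ A' := Or.inr ⟨(e, e'), ⟨he, he'⟩, rfl⟩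
    rw [← sub_nonneg, root_sub_root he.2 he'.2] at hle ⊢
    have hne : (lead e * lead e' : ℚ) ≠ 0 := by
      have := mul_ne_zero he.2 he'.2
      exact_mod_cast this
    rcases lt_or_gt_of_ne hne with hneg | hpos
    · have : (resultant e e' p : ℚ) ≤ 0 := by
        by_contra hcon
        push Not at hcon
        have := div_neg_of_pos_of_neg hcon hneg
        linarith
      have := hsign_nonpos _ hmem (by exact_mod_cast this) v hv
      exact div_nonneg_of_nonpos (by exact_mod_cast this) hneg.le
    · have : (0 : ℚ) ≤ resultant e e' p := by
        by_contra hcon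
        push Not at hcon
        have := div_neg_of_neg_of_pos hcon hpos
        linarith
      have := hsign_nonneg _ hmem (by exact_mod_cast this) v hv
      exact div_nonneg (by exact_mod_cast this) hpos.le
  -- the largest lower bound `L` and the smallest upper bound `U`
  obtain ⟨L, ⟨hLB, hL⟩, hLmax⟩ := Set.exists_max_image {b ∈ B | 0 < lead b} (fun b => root b p)
    (hB.subset (Set.sep_subset _ _)) ⟨_, h0, by simp [lead]⟩
  obtain ⟨U, ⟨hUB, hU⟩, hUmin⟩ := Set.exists_min_image {b ∈ B | lead b < 0} (fun b => root b p)
    (hB.subset (Set.sep_subset _ _)) ⟨_, h1, by simp [lead]⟩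
  have hLE : L ∈ E := ⟨Or.inr hLB, hL.ne'⟩
  have hUE : U ∈ E := ⟨Or.inr hUB, hU.ne⟩
  have hLU : root L p ≤ root U p := by
    rw [← sub_nonneg, root_sub_root hL.ne' hU.ne]
    have h2 : 0 ≤ (-resultant L U) p := hp.1 _ (Or.inr ⟨(L, U), ⟨⟨hLB, hL⟩, hUB, hU⟩, rfl⟩)
    have h3 : (resultant L U p : ℚ) ≤ 0 := by
      simp only [AddMonoidHom.neg_apply] at h2
      exact_mod_cast (by omega : resultant L U p ≤ 0)
    have h4 : (lead L * lead U : ℚ) ≤ 0 := by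
      exact_mod_cast (mul_neg_of_pos_of_neg hL hU).le
    exact div_nonneg_of_nonpos h3 h4
  have hfib : ∀ v ∈ C, ∀ y : ℤ, (v, y) ∈ cone B ↔ root L v ≤ y ∧ y ≤ root U v := by
    intro v hv y
    refine ⟨fun h => ⟨root_le_of_nonneg hL (h L hLB), le_root_of_nonneg hU (h U hUB)⟩, ?_⟩
    rintro ⟨hy1, hy2⟩ b hb
    rcases lt_trichotomy (lead b) 0 with hb0 | hb0 | hb0
    · exact nonneg_of_le_root hb0 (hy2.trans
        (hord U hUE b ⟨Or.inr hb, hb0.ne⟩ (hUmin b ⟨hb, hb0⟩) v hv))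
    · rw [apply_eq_base_add, hb0, zero_mul, add_zero]
      exact hv.1 _ (Or.inl ⟨b, ⟨hb, hb0⟩, rfl⟩)
    · exact nonneg_of_root_le hb0 ((hord b ⟨Or.inr hb, hb0.ne'⟩ L hLE (hLmax b ⟨hb, hb0⟩) v
        hv).trans hy1)
  -- between two roots that are adjacent at `p`, all of `A` has constant sign
  have hregion : ∀ e₁ ∈ E, ∀ e₂ ∈ E, root L p ≤ root e₁ p → root e₂ p ≤ root U p →
      (∀ e ∈ E, root e p ≤ root e₁ p ∨ root e₂ p ≤ root e p) →
      ∃ q : V × ℤ → ℚ, IsQuasiPoly q ∧ ∀ v ∈ C, ∀ y : ℤ, root e₁ v ≤ y → y ≤ root e₂ v →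
        f (v, y) = q (v, y) := by
    intro e₁ he₁ e₂ he₂ hLe₁ he₂U hadj
    obtain ⟨q, hq, hqf⟩ := hf {a | (lead a = 0 ∧ 0 ≤ base a p) ∨
      (0 < lead a ∧ root a p ≤ root e₁ p) ∨ (lead a < 0 ∧ root e₁ p < root a p)}
    refine ⟨q, hq, fun v hv y hy1 hy2 => hqf _ ⟨?_, ?_⟩⟩
    · exact (hfib v hv y).2 ⟨(hord L hLE e₁ he₁ hLe₁ v hv).trans hy1,
        hy2.trans (hord e₂ he₂ U hUE he₂U v hv)⟩
    · intro a ha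
      have hbase : base a ∈ A' := Or.inl ⟨a, ha, rfl⟩
      have hlow : lead a ≠ 0 → root a p ≤ root e₁ p → root a v ≤ y := fun h3 h4 =>
        (hord a ⟨Or.inl ha, h3⟩ e₁ he₁ h4 v hv).trans hy1
      have hupp : lead a ≠ 0 → root e₁ p < root a p → y ≤ root a v := fun h3 h4 =>
        hy2.trans (hord e₂ he₂ a ⟨Or.inl ha, h3⟩
          ((hadj a ⟨Or.inl ha, h3⟩).resolve_left (not_le.2 h4)) v hv)
      constructor
      · rintro (⟨h3, h4⟩ | ⟨h3, h4⟩ | ⟨h3, h4⟩)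
        · rw [apply_eq_base_add, h3, zero_mul, add_zero]
          exact hsign_nonneg _ hbase h4 v hv
        · exact nonneg_of_root_le h3 (hlow h3.ne' h4)
        · exact nonneg_of_le_root h3 (hupp h3.ne h4)
      · intro hn
        simp only [Set.mem_ofPred_eq, not_or, not_and, not_lt, not_le] at hn
        obtain ⟨n1, n2, n3⟩ := hn
        rcases lt_trichotomy (lead a) 0 with ha0 | ha0 | ha0
        · exact nonpos_of_root_le ha0 (hlow ha0.ne (n3 ha0))
        · rw [apply_eq_base_add, ha0, zero_mul, add_zero]
          exact hsign_nonpos _ hbase (n1 ha0).le v hv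
        · exact nonpos_of_le_root ha0 (hupp ha0.ne' (n2 ha0))
  -- partial sums up to a root, by induction along the roots
  have hchain : ∀ n : ℕ, ∀ e ∈ E, root L p ≤ root e p → root e p ≤ root U p →
      {e' ∈ E | root e' p < root e p}.ncard = n →
      ∃ q : V → ℚ, IsQuasiPoly q ∧ ∀ v ∈ C,
        ∑ y ∈ Finset.Icc ⌈root L v⌉ ⌊root e v⌋, f (v, y) = q v := by
    intro n
    induction n using Nat.strong_induction_on with
    | _ n ih =>
    intro e he hLe heU hn
    by_cases hbase : root e p ≤ root L p
    · obtain ⟨q, hq, hqf⟩ := hregion L hLE e he le_rfl heU fun e' _ => by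
        rcases le_total (root e' p) (root L p) with h | h
        · exact Or.inl h
        · exact Or.inr (hbase.trans h)
      obtain ⟨Q, hQ, hQd⟩ := hq.exists_antidifference
      refine ⟨_, (hQ.subst_floor (-base e) he.2).sub
        (hQ.subst_ceil_sub_one (-base L) hL.ne'), fun v hv => ?_⟩
      have heq : root L v = root e v := le_antisymm (hord L hLE e he hLe v hv)
        (hord e he L hLE hbase v hv)
      refine Eq.trans (Finset.sum_congr rfl fun y hy => ?_) (sum_Icc_of_antidifference hQd v
        (a := ⌈root L v⌉) (b := ⌊root e v⌋) ?_)
      · rw [Finset.mem_Icc, Int.ceil_le, Int.le_floor] at hy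
        exact hqf v hv y hy.1 hy.2
      · rw [heq]
        exact Int.ceil_le_floor_add_one _
    · push Not at hbase
      obtain ⟨e₁, ⟨he₁, he₁e⟩, hmax⟩ := Set.exists_max_image {e' ∈ E | root e' p < root e p}
        (fun e' => root e' p) (hE.subset (Set.sep_subset _ _)) ⟨L, hLE, hbase⟩
      have hLe₁ := hmax L ⟨hLE, hbase⟩
      obtain ⟨q₁, hq₁, hq₁f⟩ := ih _ (by
        rw [← hn]
        refine Set.ncard_lt_ncard ?_ (hE.subset (Set.sep_subset _ _))
        refine ⟨fun e' h' => ⟨h'.1, h'.2.trans he₁e⟩, fun h' => ?_⟩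
        exact lt_irrefl _ (h' (show e₁ ∈ {e' ∈ E | root e' p < root e p} from ⟨he₁, he₁e⟩)).2)
        e₁ he₁ hLe₁ (he₁e.le.trans heU) rfl
      obtain ⟨q, hq, hqf⟩ := hregion e₁ he₁ e he hLe₁ heU fun e' he' => by
        rcases lt_or_ge (root e' p) (root e p) with h | h
        · exact Or.inl (hmax e' ⟨he', h⟩)
        · exact Or.inr h
      obtain ⟨Q, hQ, hQd⟩ := hq.exists_antidifference
      refine ⟨_, hq₁.add ((hQ.subst_floor (-base e) he.2).sub
        (hQ.subst_floor (-base e₁) he₁.2)), fun v hv => ?_⟩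
      have hfl : ⌊root e₁ v⌋ ≤ ⌊root e v⌋ := Int.floor_le_floor (hord e₁ he₁ e he he₁e.le v hv)
      have hcf : ⌈root L v⌉ ≤ ⌊root e₁ v⌋ + 1 :=
        (Int.ceil_le_ceil (hord L hLE e₁ he₁ hLe₁ v hv)).trans (Int.ceil_le_floor_add_one _)
      have hunion : Finset.Icc ⌈root L v⌉ ⌊root e v⌋ =
          Finset.Icc ⌈root L v⌉ ⌊root e₁ v⌋ ∪ Finset.Icc (⌊root e₁ v⌋ + 1) ⌊root e v⌋ := by
        ext y
        simp only [Finset.mem_Icc, Finset.mem_union]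
        omega
      rw [hunion, Finset.sum_union (by
        rw [Finset.disjoint_left]
        intro y hy hy'
        rw [Finset.mem_Icc] at hy hy'
        omega), hq₁f v hv]
      congr 1
      refine Eq.trans (Finset.sum_congr rfl fun y hy => ?_) ((sum_Icc_of_antidifference hQd v
        (a := ⌊root e₁ v⌋ + 1) (b := ⌊root e v⌋) (by omega)).trans ?_)
      · rw [Finset.mem_Icc, Int.le_floor] at hy
        exact hqf v hv y ((Int.lt_floor_add_one _).le.trans (by exact_mod_cast hy.1)) hy.2
      · rw [add_sub_cancel_right]
        rfl
  obtain ⟨q, hq, hqf⟩ := hchain _ U hUE hLU le_rfl rfl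
  refine ⟨q, hq, fun v hv => ?_⟩
  rw [← hqf v hv]
  beta_reduce
  rw [← Finset.sum_filter]
  refine Finset.sum_congr ?_ fun _ _ => rfl
  ext y
  rw [Finset.mem_filter, hfib v hv, Finset.mem_Icc, Finset.mem_Icc, Int.ceil_le, Int.le_floor,
    and_iff_right_iff_imp, ← hfib v hv]
  intro h
  have h2 := h _ h0
  have h3 := h _ h1
  simp at h2 h3
  exact ⟨h2, h3⟩

theorem mem_cone_comp {W : Type} [AddCommGroup W] (φ : V →+ W) (B : Set (W →+ ℤ)) (v : V) :
    v ∈ cone ((fun b : W →+ ℤ => b.comp φ) '' B) ↔ φ v ∈ cone B :=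
  Set.forall_mem_image

theorem IsPiecewise.comp {W : Type} [AddCommGroup W] (φ : V →+ W) {B : Set (W →+ ℤ)} {f : W → ℚ}
    (hf : IsPiecewise B f) :
    IsPiecewise ((fun b : W →+ ℤ => b.comp φ) '' B) (fun v => f (φ v)) := by
  obtain ⟨A, hA, h⟩ := hf
  refine ⟨_, hA.image fun a : W →+ ℤ => a.comp φ, fun S => ?_⟩
  obtain ⟨q, hq, hqf⟩ := h {a | a.comp φ ∈ S}
  refine ⟨_, hq.comp φ, fun v hv => hqf _ ⟨(mem_cone_comp φ B v).1 hv.1, fun a ha => ?_⟩⟩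
  exact hv.2 _ ⟨a, ha, rfl⟩

/-- The isomorphism that splits off the first of `m + 1` integer variables. -/
def consHom (V : Type) [AddCommGroup V] (m : ℕ) :
    (V × (Fin m → ℤ)) × ℤ →+ V × (Fin (m + 1) → ℤ) where
  toFun w := (w.1.1, Fin.cons w.2 w.1.2)
  map_zero' := by
    ext i
    · rfl
    · refine Fin.cases ?_ (fun j => ?_) i <;> simp
  map_add' w w' := by
    ext i
    · rfl
    · refine Fin.cases ?_ (fun j => ?_) i <;> simp

/-- The form reading off the `i`-th variable. -/
def coordForm (V : Type) [AddCommGroup V] {ι : Type} (i : ι) : V × (ι → ℤ) →+ ℤ :=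
  (Pi.evalAddMonoidHom (fun _ : ι => ℤ) i).comp (AddMonoidHom.snd V (ι → ℤ))

/-- The form `s` minus the `i`-th variable. -/
def slackForm {ι : Type} (s : V →+ ℤ) (i : ι) : V × (ι → ℤ) →+ ℤ :=
  s.comp (AddMonoidHom.fst V (ι → ℤ)) - coordForm V i

theorem sum_piFinset_cons {m : ℕ} (t : Finset ℤ) (F : (Fin (m + 1) → ℤ) → ℚ) :
    ∑ x ∈ Fintype.piFinset (fun _ : Fin (m + 1) => t), F x =
      ∑ x ∈ Fintype.piFinset (fun _ : Fin m => t), ∑ y ∈ t, F (Fin.cons y x) := by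
  rw [← Finset.sum_product']
  symm
  refine Finset.sum_bij' (fun w _ => Fin.cons w.2 w.1) (fun x _ => (Fin.tail x, x 0)) ?_ ?_ ?_ ?_ ?_
  · rintro ⟨x, y⟩ h
    simp only [Finset.mem_product, Fintype.mem_piFinset] at h ⊢
    exact fun i => Fin.cases h.2 (fun j => h.1 j) i
  · intro x h
    simp only [Finset.mem_product, Fintype.mem_piFinset] at h ⊢
    exact ⟨fun i => h i.succ, h 0⟩
  · rintro ⟨x, y⟩ _
    simp
  · intro x _
    simp
  · intros
    rfl

/-- Summing a piecewise quasi-polynomial over all lattice points of the bounded fibres of a cone: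
the last variables are eliminated one at a time. -/
theorem IsPiecewise.elim_box (m : ℕ) : ∀ {V : Type} [AddCommGroup V]
    {B : Set (V × (Fin m → ℤ) →+ ℤ)} (_ : B.Finite) {f : V × (Fin m → ℤ) → ℚ}
    (_ : IsPiecewise B f) (s : V →+ ℤ) (_ : ∀ i, coordForm V i ∈ B) (_ : ∀ i, slackForm s i ∈ B),
    ∃ B' : Set (V →+ ℤ), B'.Finite ∧
      (∀ (k : ℕ) (v : V) (x : Fin m → ℤ), 0 < k → (k • v, x) ∈ cone B → v ∈ cone B') ∧
      IsPiecewise B' (fun v => ∑ x ∈ Fintype.piFinset (fun _ : Fin m => Finset.Icc 0 (s v)),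
        open scoped Classical in if (v, x) ∈ cone B then f (v, x) else 0) := by
  classical
  induction m with
  | zero =>
    intro V _ B hB f hf s _ _
    let φ : V →+ V × (Fin 0 → ℤ) := AddMonoidHom.inl V (Fin 0 → ℤ)
    refine ⟨_, hB.image fun b => b.comp φ, ?_, ?_⟩
    · intro k v x hk h
      rw [mem_cone_comp]
      intro b hb
      have h2 := h b hb
      have h3 : (k • v, x) = k • φ v := by
        ext i
        · rfl
        · exact i.elim0
      rw [h3, map_nsmul, nsmul_eq_mul] at h2
      exact nonneg_of_mul_nonneg_right h2 (by exact_mod_cast hk)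
    · obtain ⟨A, hA, h⟩ := hf.comp φ
      refine ⟨A, hA, fun S => ?_⟩
      obtain ⟨q, hq, hqf⟩ := h S
      refine ⟨q, hq, fun v hv => ?_⟩
      rw [← hqf v hv]
      have hv1 := (mem_cone_comp φ B v).1 hv.1
      have h0 : ∀ x : Fin 0 → ℤ, (v, x) = φ v := fun x => by
        ext i
        · rfl
        · exact i.elim0
      simp [h0, hv1]
  | succ m ih =>
    intro V _ B hB f hf s h0 h1
    let φ := consHom V m
    let B₁ := (fun b : V × (Fin (m + 1) → ℤ) →+ ℤ => b.comp φ) '' B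
    have hB₁ : B₁.Finite := hB.image _
    have hf₁ : IsPiecewise B₁ (fun w => f (φ w)) := hf.comp φ
    have hf₂ := hf₁.elim hB₁ (s.comp (AddMonoidHom.fst V (Fin m → ℤ)))
      ⟨_, h0 0, by ext; all_goals simp [coordForm, φ, consHom]⟩
      ⟨_, h1 0, by ext; all_goals simp [coordForm, slackForm, φ, consHom]⟩
    have hmem : ∀ b : V × (Fin m → ℤ) →+ ℤ,
        b.comp (AddMonoidHom.fst (V × (Fin m → ℤ)) ℤ) ∈ B₁ → b ∈ fourierMotzkin B₁ := by
      intro b hb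
      refine Or.inl ⟨_, ⟨hb, by simp [lead]⟩, ?_⟩
      ext; all_goals simp [base]
    obtain ⟨B', hB', hproj, hpw⟩ := ih (fourierMotzkin_finite hB₁) hf₂ s
      (fun i => hmem _ ⟨_, h0 i.succ, by
        apply AddMonoidHom.ext
        rintro ⟨⟨v, x⟩, y⟩
        simp [coordForm, φ, consHom]⟩)
      (fun i => hmem _ ⟨_, h1 i.succ, by
        apply AddMonoidHom.ext
        rintro ⟨⟨v, x⟩, y⟩
        simp [coordForm, slackForm, φ, consHom]⟩)
    refine ⟨B', hB', fun k v x hk h => ?_, ?_⟩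
    · refine hproj k v (Fin.tail x) hk (mem_cone_fourierMotzkin (k := 1) (y := x 0) one_pos ?_)
      rw [mem_cone_comp]
      simpa [φ, consHom] using h
    · convert hpw using 2 with v
      rw [sum_piFinset_cons]
      refine Finset.sum_congr rfl fun x _ => ?_
      have hy : ∀ y : ℤ, ((v, x), y) ∈ cone B₁ ↔ (v, Fin.cons y x) ∈ cone B := fun y =>
        mem_cone_comp φ B _
      split_ifs with hc
      · refine Finset.sum_congr rfl fun y _ => ?_
        simp only [hy]
        rfl
      · refine Finset.sum_eq_zero fun y _ => if_neg fun h => hc ?_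
        refine mem_cone_fourierMotzkin (k := 1) (y := y) one_pos ?_
        rw [one_smul, hy]
        exact h

end

/-- Ehrhart's theorem for the slices of a rational cone: the number of lattice points of the slice
at height `s` is a quasi-polynomial in `s ≥ 0`, including `s = 0`. -/
theorem exists_quasiPoly_ncard {ι : Type} [Fintype ι] {B : Set (ℤ × (ι → ℤ) →+ ℤ)} (hB : B.Finite)
    (h0 : ∀ i, coordForm ℤ i ∈ B) (h1 : ∀ i, slackForm (AddMonoidHom.id ℤ) i ∈ B)
    {k : ℕ} (hk : 0 < k) {x₀ : ι → ℤ} (hx₀ : ((k : ℤ), x₀) ∈ cone B) :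
    ∃ q : ℤ → ℚ, IsQuasiPoly q ∧
      ∀ s : ℤ, 0 ≤ s → (({x : ι → ℤ | (s, x) ∈ cone B}.ncard : ℕ) : ℚ) = q s := by
  classical
  let m := Fintype.card ι
  let e : ι ≃ Fin m := Fintype.equivFin ι
  let φ : ℤ × (Fin m → ℤ) →+ ℤ × (ι → ℤ) :=
    { toFun := fun w => (w.1, w.2 ∘ e)
      map_zero' := rfl
      map_add' := fun _ _ => rfl }
  let B₁ := (fun b : ℤ × (ι → ℤ) →+ ℤ => b.comp φ) '' B
  have hone : IsPiecewise B₁ (fun _ => (1 : ℚ)) :=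
    ⟨∅, Set.finite_empty, fun _ => ⟨_, IsQuasiPoly.const 1, fun _ _ => rfl⟩⟩
  obtain ⟨B', -, hproj, A, hA, hq⟩ := hone.elim_box m (hB.image _) (AddMonoidHom.id ℤ)
    (fun i => ⟨_, h0 (e.symm i), by
      apply AddMonoidHom.ext
      rintro ⟨v, x⟩
      simp [coordForm, φ]⟩)
    (fun i => ⟨_, h1 (e.symm i), by
      apply AddMonoidHom.ext
      rintro ⟨v, x⟩
      simp [coordForm, slackForm, φ]⟩)
  have h1B : (1 : ℤ) ∈ cone B' := by
    refine hproj k 1 (x₀ ∘ e.symm) hk ((mem_cone_comp φ B _).2 ?_)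
    have : φ (k • 1, x₀ ∘ e.symm) = ((k : ℤ), x₀) := by
      ext i <;> simp [φ]
    rwa [this]
  obtain ⟨q, hq, hqf⟩ := hq {a | 0 ≤ a 1}
  refine ⟨q, hq, fun s hs => ?_⟩
  have hform : ∀ a : ℤ →+ ℤ, a s = s * a 1 := fun a => by
    have : s = s • (1 : ℤ) := by simp
    conv_lhs => rw [this, map_zsmul, smul_eq_mul]
  have hmem : s ∈ cone B' ⊓ chamber A {a | 0 ≤ a 1} := by
    refine ⟨fun b hb => ?_, fun a _ => ⟨fun h => ?_, fun h => ?_⟩⟩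
    · rw [hform]
      exact mul_nonneg hs (h1B b hb)
    · rw [hform]
      exact mul_nonneg hs h
    · rw [hform]
      exact mul_nonpos_of_nonneg_of_nonpos hs (not_le.1 h).le
  rw [← hqf s hmem]
  beta_reduce
  rw [← Finset.sum_filter, Finset.sum_const, nsmul_eq_mul, mul_one]
  congr 1
  rw [← Set.ncard_coe_finset]
  refine Set.ncard_congr (fun x _ => x ∘ e.symm) ?_ ?_ ?_
  · intro x hx
    have hx' : (s, x ∘ e.symm) ∈ cone B₁ := by
      refine (mem_cone_comp φ B _).2 ?_
      have : φ (s, x ∘ e.symm) = (s, x) := by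
        ext i <;> simp [φ]
      rwa [this]
    simp only [Finset.coe_filter, Fintype.mem_piFinset, Finset.mem_Icc, Set.mem_ofPred_eq]
    refine ⟨fun i => ⟨?_, ?_⟩, hx'⟩
    · exact hx _ (h0 (e.symm i))
    · have := hx _ (h1 (e.symm i))
      simpa [slackForm, coordForm] using this
  · intro x y _ _ h
    ext i
    simpa using congrFun h (e i)
  · intro x hx
    simp only [Finset.coe_filter, Set.mem_ofPred_eq] at hx
    exact ⟨x ∘ e, (mem_cone_comp φ B _).1 hx.2, by ext i; simp⟩

/-! ### The degree of a quasi-polynomial from the growth of its values -/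

theorem exists_polynomial_of_mem_polyFun_int {f : ℤ → ℚ} (hf : f ∈ polyFun ℤ) :
    ∃ P : Polynomial ℚ, ∀ z : ℤ, f z = P.eval (z : ℚ) := by
  induction hf using Algebra.adjoin_induction with
  | mem g hg =>
    obtain ⟨ℓ, rfl⟩ := hg
    refine ⟨Polynomial.X * Polynomial.C (ℓ 1 : ℚ), fun z => ?_⟩
    have : ℓ z = z * ℓ 1 := by
      conv_lhs => rw [← mul_one z, ← smul_eq_mul, map_zsmul, smul_eq_mul]
    simp [this]
  | algebraMap c => exact ⟨Polynomial.C c, fun z => by simp⟩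
  | add f g _ _ hf hg =>
    obtain ⟨P, hP⟩ := hf
    obtain ⟨Q, hQ⟩ := hg
    exact ⟨P + Q, fun z => by simp [hP, hQ]⟩
  | mul f g _ _ hf hg =>
    obtain ⟨P, hP⟩ := hf
    obtain ⟨Q, hQ⟩ := hg
    exact ⟨P * Q, fun z => by simp [hP, hQ]⟩

theorem degree_le_of_eval_le {P : Polynomial ℚ} {a b : ℚ} (ha : 0 < a) {D : ℕ}
    (h0 : ∀ z : ℕ, 0 ≤ P.eval (z : ℚ)) (h : ∀ z : ℕ, P.eval (z : ℚ) ≤ (a * z + b) ^ D) :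
    P.degree ≤ D := by
  by_contra hcon
  push Not at hcon
  let R : Polynomial ℚ := (Polynomial.C a * Polynomial.X + Polynomial.C b) ^ D
  have hlin : (Polynomial.C a * Polynomial.X + Polynomial.C b).degree = 1 :=
    Polynomial.degree_linear ha.ne'
  have hR : R.degree = D := by
    rw [Polynomial.degree_pow, hlin]
    simp
  have hR0 : R ≠ 0 := by
    intro h
    simp [h] at hR
  have ht := (Polynomial.abs_div_tendsto_atTop_atTop_of_degree_gt P R (by rwa [hR]) hR0).comp
    (tendsto_natCast_atTop_atTop (R := ℚ))
  obtain ⟨z, hz⟩ := (ht.eventually_gt_atTop 1).exists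
  have hz0 := h0 z
  have hz1 : P.eval (z : ℚ) ≤ R.eval (z : ℚ) := by simpa [R] using h z
  simp only [Function.comp_apply] at hz
  rw [abs_of_nonneg (div_nonneg hz0 (hz0.trans hz1))] at hz
  exact absurd (div_le_one_of_le₀ hz1 (hz0.trans hz1)) (not_le.2 hz)

theorem not_degree_lt_of_pow_le {P : Polynomial ℚ} {k D : ℕ} (hk : 0 < k)
    (h : ∀ t : ℕ, (t : ℚ) ^ D ≤ P.eval ((k : ℚ) * t)) : ¬ P.degree < D := by
  intro hlt
  have ht := Polynomial.div_tendsto_atTop_zero_of_degree_lt P (Polynomial.X ^ D : Polynomial ℚ)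
    (by simpa using hlt)
  have hk' : (0 : ℚ) < k := by exact_mod_cast hk
  have ht2 := ht.comp ((tendsto_natCast_atTop_atTop (R := ℚ)).const_mul_atTop hk')
  have hpos : (0 : ℚ) < 1 / (k : ℚ) ^ D := by positivity
  obtain ⟨t, ht3, ht1⟩ := ((ht2.eventually_lt_const hpos).and
    (Filter.eventually_ge_atTop 1)).exists
  have ht0 : (0 : ℚ) < t := by exact_mod_cast ht1
  simp only [Function.comp_apply, Polynomial.eval_pow, Polynomial.eval_X] at ht3
  rw [div_lt_div_iff₀ (by positivity) (by positivity), one_mul, mul_pow] at ht3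
  have := mul_le_mul_of_nonneg_right (h t) (by positivity : (0 : ℚ) ≤ (k : ℚ) ^ D)
  nlinarith

/-- A quasi-polynomial counting function that is at most `(s + 1) ^ D` everywhere, and at least
`t ^ D` at the multiples `k * t` of some `k`, has degree `D`. -/
theorem isQuasipolynomialOfDegree_of_growth {f : ℕ → ℕ} {q : ℤ → ℚ} (hq : IsQuasiPoly q)
    (hfq : ∀ s : ℕ, (f s : ℚ) = q s) {D k : ℕ} (hup : ∀ s, f s ≤ (s + 1) ^ D) (hk : 0 < k)
    (hlow : ∀ t, t ^ D ≤ f (k * t)) :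
    IsQuasipolynomialOfDegree (fun s => (f s : ℂ)) D := by
  obtain ⟨N, hN, hq⟩ := hq
  have hN' : (N : ℚ) ≠ 0 := by exact_mod_cast hN.ne'
  choose P hP using fun r : ℤ => exists_polynomial_of_mem_polyFun_int (hq r)
  have hPf : ∀ i z : ℕ, (f (i + N * z) : ℚ) = (P i).eval (z : ℚ) := by
    intro i z
    have := hP i z
    rw [hfq]
    simpa using this
  have hdeg : ∀ i : ℕ, (P i).degree ≤ D := by
    intro i
    refine degree_le_of_eval_le (a := N) (b := i + 1) (by exact_mod_cast hN) ?_ ?_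
    · intro z
      rw [← hPf]
      positivity
    · intro z
      rw [← hPf]
      have h2 : (f (i + N * z) : ℚ) ≤ ((i + N * z : ℕ) + 1 : ℚ) ^ D := by exact_mod_cast hup _
      convert h2 using 2
      push_cast
      ring
  have hdeg0 : ¬ (P 0).degree < D := by
    refine not_degree_lt_of_pow_le hk fun t => ?_
    have h2 := hPf 0 (k * t)
    push_cast at h2
    rw [← h2]
    have h3 := hlow (N * t)
    rw [show k * (N * t) = 0 + N * (k * t) by ring] at h3
    have h4 : t ^ D ≤ f (0 + N * (k * t)) :=
      (Nat.pow_le_pow_left (Nat.le_mul_of_pos_left t hN) D).trans h3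
    exact_mod_cast h4
  have hlin : ∀ i : ℕ, (Polynomial.C (N : ℚ)⁻¹ * Polynomial.X +
      Polynomial.C (-(i : ℚ) / N)).natDegree = 1 :=
    fun i => Polynomial.natDegree_linear (inv_ne_zero hN')
  have hcomp : ∀ i : ℕ, ((P i).comp (Polynomial.C (N : ℚ)⁻¹ * Polynomial.X +
      Polynomial.C (-(i : ℚ) / N))).degree = (P i).degree := by
    intro i
    by_cases h0 : P i = 0
    · simp [h0]
    · have h1 : (P i).comp (Polynomial.C (N : ℚ)⁻¹ * Polynomial.X +
          Polynomial.C (-(i : ℚ) / N)) ≠ 0 := by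
        intro h
        rcases Polynomial.comp_eq_zero_iff.1 h with h | ⟨-, h⟩
        · exact h0 h
        · have := hlin i
          rw [h] at this
          simp at this
      rw [Polynomial.degree_eq_natDegree h1, Polynomial.degree_eq_natDegree h0,
        Polynomial.natDegree_comp, hlin, mul_one]
  refine ⟨N, hN, fun i => ((P (i : ℕ)).comp (Polynomial.C (N : ℚ)⁻¹ * Polynomial.X +
      Polynomial.C (-((i : ℕ) : ℚ) / N))).map (algebraMap ℚ ℂ), ?_, ?_, ?_⟩
  · intro m i hmi
    have hi : m % N = i := by
      rw [hmi, Nat.mod_eq_of_lt i.2]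
    obtain ⟨z, rfl⟩ : ∃ z, m = i + N * z := ⟨m / N, by rw [← hi, Nat.mod_add_div]⟩
    have h2 := hPf i z
    have h3 : (((i : ℕ) + N * z : ℕ) : ℂ) = algebraMap ℚ ℂ (((i : ℕ) : ℚ) + N * z) := by simp
    rw [h3, Polynomial.eval_map_algebraMap, Polynomial.aeval_algebraMap_apply,
      Polynomial.coe_aeval_eq_eval,
      Polynomial.eval_comp]
    have h4 : (Polynomial.C (N : ℚ)⁻¹ * Polynomial.X +
      Polynomial.C (-((i : ℕ) : ℚ) / N)).eval (((i : ℕ) : ℚ) + N * z) = (z : ℚ) := by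
      simp only [Polynomial.eval_add, Polynomial.eval_mul, Polynomial.eval_C, Polynomial.eval_X]
      field_simp
      ring
    rw [h4, ← h2]
    simp
  · intro i
    rw [Polynomial.degree_map, hcomp]
    exact hdeg i
  · refine ⟨⟨0, hN⟩, ?_⟩
    rw [Polynomial.degree_map, hcomp]
    exact le_antisymm (hdeg 0) (not_lt.1 hdeg0)

/-! ### Counting nonnegative arrays with prescribed line sums -/

section

variable {ι : Type}

/-- A subspace of `ι → ℚ` is determined by some family of at most `finrank` coordinates. -/
theorem exists_determining_coords [Fintype ι] : ∀ (D : ℕ) (W : Submodule ℚ (ι → ℚ)),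
    Module.finrank ℚ W ≤ D →
    ∃ I : Finset ι, I.card ≤ D ∧ ∀ w ∈ W, (∀ i ∈ I, w i = 0) → w = 0 := by
  classical
  intro D
  induction D with
  | zero =>
    intro W hW
    have : W = ⊥ := Submodule.finrank_eq_zero.1 (by omega)
    exact ⟨∅, by simp, fun w hw _ => by simpa [this] using hw⟩
  | succ D ih =>
    intro W hW
    by_cases hbot : W = ⊥
    · exact ⟨∅, by simp, fun w hw _ => by simpa [hbot] using hw⟩
    obtain ⟨w, hw, hw0⟩ := Submodule.exists_mem_ne_zero_of_ne_bot hbot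
    obtain ⟨i, hi⟩ := Function.ne_iff.1 hw0
    let W' := W ⊓ LinearMap.ker (LinearMap.proj i : (ι → ℚ) →ₗ[ℚ] ℚ)
    have hlt : W' < W := by
      refine lt_of_le_of_ne inf_le_left fun h => hi ?_
      have : w ∈ W' := h ▸ hw
      exact this.2
    obtain ⟨I, hI, hdet⟩ := ih W' (by
      have := Submodule.finrank_lt_finrank_of_lt hlt
      omega)
    refine ⟨insert i I, (Finset.card_insert_le _ _).trans (by omega), fun v hv h => ?_⟩
    exact hdet v ⟨hv, h i (Finset.mem_insert_self _ _)⟩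
      fun j hj => h j (Finset.mem_insert_of_mem hj)

/-- A rational subspace has a basis of integer vectors. -/
theorem exists_integer_linearIndependent [Fintype ι] (W : Submodule ℚ (ι → ℚ)) {D : ℕ}
    (hD : Module.finrank ℚ W = D) : ∃ w : Fin D → ι → ℤ, (∀ j, (fun i => (w j i : ℚ)) ∈ W) ∧
      LinearIndependent ℚ (fun j i => (w j i : ℚ)) := by
  let b := Module.finBasisOfFinrankEq ℚ W hD
  have hint : ∀ v : ι → ℚ, ∃ c : ℤ, c ≠ 0 ∧ ∃ z : ι → ℤ, ∀ i, (z i : ℚ) = c * v i := by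
    intro v
    refine ⟨∏ i, ((v i).den : ℤ), ?_, ?_⟩
    · exact Finset.prod_ne_zero_iff.2 fun i _ => by exact_mod_cast (v i).den_ne_zero
    · have : ∀ i, ∃ z : ℤ, (z : ℚ) = ((∏ i, ((v i).den : ℤ) : ℤ) : ℚ) * v i := by
        intro i
        obtain ⟨e, he⟩ := Finset.dvd_prod_of_mem (fun i => ((v i).den : ℤ)) (Finset.mem_univ i)
        refine ⟨(v i).num * e, ?_⟩
        rw [he]
        push_cast
        rw [mul_right_comm, Rat.den_mul_eq_num]
      choose z hz using this
      exact ⟨z, hz⟩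
  choose c hc z hz using fun j => hint (b j)
  have hz' : ∀ j, (fun i => (z j i : ℚ)) = (c j : ℚ) • (b j : ι → ℚ) := fun j => by
    ext i
    simp [hz]
  refine ⟨z, fun j => ?_, ?_⟩
  · rw [hz']
    exact W.smul_mem _ (b j).2
  · have h1 : LinearIndependent ℚ (fun j => (b j : ι → ℚ)) :=
      b.linearIndependent.map' W.subtype W.ker_subtype
    have h2 := h1.units_smul fun j => Units.mk0 (c j : ℚ) (by exact_mod_cast hc j)
    convert h2 using 1
    ext j i
    simp [hz, Units.smul_def]

variable {J : Type} {n : ℕ}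

/-- Given a family of lines of `n` cells each, the rational arrays with all line sums zero. -/
def zeroLineSums (line : J → Fin n → ι) : Submodule ℚ (ι → ℚ) where
  carrier := {x | ∀ j, ∑ k, x (line j k) = 0}
  zero_mem' := fun j => by simp
  add_mem' := fun {x y} hx hy j => by
    simp only [Pi.add_apply, Finset.sum_add_distrib, hx j, hy j, add_zero]
  smul_mem' := fun c x hx j => by
    simp only [Pi.smul_apply, smul_eq_mul, ← Finset.mul_sum, hx j, mul_zero]

/-- Given a family of lines, the arrays of natural numbers with all line sums `s`. -/
def natLineSums (line : J → Fin n → ι) (s : ℕ) : Set (ι → ℕ) :=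
  {x | ∀ j, ∑ k, x (line j k) = s}

/-- The form on pairs `(s, x)` whose vanishing says that the `j`-th line sum of `x` is `s`. -/
def lineForm (line : J → Fin n → ι) (j : J) : ℤ × (ι → ℤ) →+ ℤ :=
  ∑ k, coordForm ℤ (line j k) - AddMonoidHom.fst ℤ (ι → ℤ)

theorem lineForm_apply (line : J → Fin n → ι) (j : J) (s : ℤ) (x : ι → ℤ) :
    lineForm line j (s, x) = ∑ k, x (line j k) - s := by
  simp [lineForm, coordForm]

theorem le_of_mem_natLineSums {line : J → Fin n → ι} (hcov : ∀ i, ∃ j k, line j k = i) {s : ℕ}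
    {x : ι → ℕ} (hx : x ∈ natLineSums line s) (i : ι) : x i ≤ s := by
  obtain ⟨j, k, rfl⟩ := hcov i
  rw [← hx j]
  exact Finset.single_le_sum (f := fun k => x (line j k)) (fun _ _ => Nat.zero_le _)
    (Finset.mem_univ k)

theorem natLineSums_finite [Fintype ι] {line : J → Fin n → ι}
    (hcov : ∀ i, ∃ j k, line j k = i) (s : ℕ) :
    (natLineSums line s).Finite :=
  (Set.Finite.pi' fun _ : ι => Set.finite_Iic s).subset fun _ hx => le_of_mem_natLineSums hcov hx

theorem ncard_natLineSums_le [Fintype ι] {line : J → Fin n → ι}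
    (hcov : ∀ i, ∃ j k, line j k = i) (s : ℕ) :
    (natLineSums line s).ncard ≤ (s + 1) ^ Module.finrank ℚ (zeroLineSums line) := by
  classical
  obtain ⟨I, hI, hdet⟩ := exists_determining_coords _ (zeroLineSums line) le_rfl
  have h1 : (natLineSums line s).ncard ≤ (Set.univ : Set (I → Fin (s + 1))).ncard := by
    refine Set.ncard_le_ncard_of_injOn (fun x i => Fin.ofNat (s + 1) (x i))
      (fun _ _ => Set.mem_univ _) ?_ Set.finite_univ
    intro x hx y hy hxy
    have hcoord : ∀ i ∈ I, x i = y i := by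
      intro i hi
      have h2 := congrArg Fin.val (congrFun hxy ⟨i, hi⟩)
      simpa [Fin.ofNat, Nat.mod_eq_of_lt (Nat.lt_succ_of_le (le_of_mem_natLineSums hcov hx i)),
        Nat.mod_eq_of_lt (Nat.lt_succ_of_le (le_of_mem_natLineSums hcov hy i))] using h2
    have h3 := hdet (fun i => (x i : ℚ) - y i) (fun j => by
      rw [Finset.sum_sub_distrib, sub_eq_zero]
      exact_mod_cast (hx j).trans (hy j).symm) fun i hi => by simp [hcoord i hi]
    ext i
    have h4 := congrFun h3 i
    simp only [Pi.zero_apply, sub_eq_zero] at h4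
    exact_mod_cast h4
  rw [Set.ncard_univ, Nat.card_eq_fintype_card, Fintype.card_fun, Fintype.card_fin,
    Fintype.card_coe] at h1
  exact h1.trans (Nat.pow_le_pow_right (Nat.succ_pos s) hI)

/-- Perturbing a large constant array by integer combinations of independent zero-sum arrays gives
many arrays of natural numbers with equal line sums. -/
theorem exists_pow_le_ncard_natLineSums [Fintype ι] {line : J → Fin n → ι}
    (hcov : ∀ i, ∃ j k, line j k = i)
    (hn : 0 < n) : ∃ k : ℕ, 0 < k ∧ ∀ t : ℕ,
      t ^ Module.finrank ℚ (zeroLineSums line) ≤ (natLineSums line (k * t)).ncard := by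
  generalize hD : Module.finrank ℚ (zeroLineSums line) = D
  obtain ⟨w, hw, hli⟩ := exists_integer_linearIndependent (zeroLineSums line) hD
  let c : ℕ := 1 + ∑ i, ∑ j, (w j i).natAbs
  have hwsum : ∀ j l, ∑ k, w j (line l k) = 0 := fun j l => by
    have := hw j l
    beta_reduce at this
    exact_mod_cast this
  refine ⟨n * c, by positivity, fun t => ?_⟩
  let g : (Fin D → Fin t) → ι → ℤ := fun a i => c * t + ∑ j, (a j : ℤ) * w j i
  have hg0 : ∀ a i, 0 ≤ g a i := by
    intro a i
    have h1 : |∑ j, ((a j : ℕ) : ℤ) * w j i| ≤ c * t := by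
      calc |∑ j, ((a j : ℕ) : ℤ) * w j i|
          ≤ ∑ j, |((a j : ℕ) : ℤ) * w j i| := Finset.abs_sum_le_sum_abs _ _
        _ ≤ ∑ j, (t : ℤ) * (w j i).natAbs := by
            refine Finset.sum_le_sum fun j _ => ?_
            rw [abs_mul, Int.natCast_natAbs, abs_of_nonneg (Int.natCast_nonneg _)]
            refine mul_le_mul_of_nonneg_right ?_ (abs_nonneg _)
            exact_mod_cast (a j).2.le
        _ = t * ((∑ j, (w j i).natAbs : ℕ) : ℤ) := by
            rw [← Finset.mul_sum]
            push_cast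
            rfl
        _ ≤ c * t := by
            rw [mul_comm]
            refine mul_le_mul_of_nonneg_right ?_ (Int.natCast_nonneg _)
            have h2 := Finset.single_le_sum (f := fun i => ∑ j, (w j i).natAbs)
              (fun _ _ => Nat.zero_le _) (Finset.mem_univ i)
            have h3 : ∑ j, (w j i).natAbs ≤ c := by
              beta_reduce at h2
              omega
            exact_mod_cast h3
    have h2 := neg_le_of_abs_le h1
    simp only [g]
    linarith
  have hinj : Function.Injective fun a i => (g a i).toNat := by
    intro a a' h
    have h1 : ∀ i, g a i = g a' i := by
      intro i
      have h2 := congrFun h i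
      have h3 := hg0 a i
      have h4 := hg0 a' i
      simp only at h2
      omega
    have h5 : ∑ j, (((a j : ℕ) : ℚ) - ((a' j : ℕ) : ℚ)) • (fun i => (w j i : ℚ)) = 0 := by
      ext i
      have h2 : ∑ j, ((a j : ℕ) : ℤ) * w j i = ∑ j, ((a' j : ℕ) : ℤ) * w j i := by
        have := h1 i
        simp only [g] at this
        linarith
      have h3 : ∑ j, ((a j : ℕ) : ℚ) * w j i = ∑ j, ((a' j : ℕ) : ℚ) * w j i := by
        exact_mod_cast h2
      simp [Finset.sum_apply, sub_mul, Finset.sum_sub_distrib, h3]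
    ext j
    have h6 := Fintype.linearIndependent_iff.1 hli _ h5 j
    rw [sub_eq_zero] at h6
    exact_mod_cast h6
  have hmem : Set.range (fun a i => (g a i).toNat) ⊆ natLineSums line (n * c * t) := by
    rintro _ ⟨a, rfl⟩ l
    have h1 : ∑ k, g a (line l k) = n * c * t := by
      simp only [g, Finset.sum_add_distrib, Finset.sum_const, Finset.card_univ, Fintype.card_fin]
      rw [Finset.sum_comm]
      simp only [← Finset.mul_sum, hwsum]
      simp
      ring
    have h2 : ((∑ k, (g a (line l k)).toNat : ℕ) : ℤ) = ((n * c * t : ℕ) : ℤ) := by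
      push_cast
      rw [← h1]
      exact Finset.sum_congr rfl fun k _ => Int.toNat_of_nonneg (hg0 a _)
    exact_mod_cast h2
  calc t ^ D = (Set.range (fun a i => (g a i).toNat)).ncard := by
        rw [← Set.image_univ, Set.ncard_image_of_injective _ hinj, Set.ncard_univ,
          Nat.card_eq_fintype_card, Fintype.card_fun, Fintype.card_fin, Fintype.card_fin]
    _ ≤ _ := Set.ncard_le_ncard hmem (natLineSums_finite hcov _)

/-- The number of arrays of natural numbers with all line sums `s` is a quasi-polynomial in `s`
whose degree is the dimension of the space of arrays with zero line sums. -/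
theorem isQuasipolynomialOfDegree_natLineSums [Fintype ι] [Fintype J] {line : J → Fin n → ι}
    (hcov : ∀ i, ∃ j k, line j k = i) (hn : 0 < n) :
    IsQuasipolynomialOfDegree (fun s => ((natLineSums line s).ncard : ℂ))
      (Module.finrank ℚ (zeroLineSums line)) := by
  let B : Set (ℤ × (ι → ℤ) →+ ℤ) := Set.range (coordForm ℤ) ∪
    Set.range (slackForm (AddMonoidHom.id ℤ)) ∪
    Set.range (lineForm line) ∪ Set.range (fun j => -lineForm line j)
  have hB : B.Finite := (((Set.finite_range _).union (Set.finite_range _)).union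
    (Set.finite_range _)).union (Set.finite_range _)
  have hmem : ∀ (s : ℤ) (x : ι → ℤ), (s, x) ∈ cone B ↔
      (∀ i, 0 ≤ x i) ∧ (∀ i, x i ≤ s) ∧ ∀ j, ∑ k, x (line j k) = s := by
    intro s x
    constructor
    · intro h
      refine ⟨fun i => ?_, fun i => ?_, fun j => ?_⟩
      · simpa [coordForm] using h _ (Or.inl (Or.inl (Or.inl ⟨i, rfl⟩)))
      · simpa [slackForm, coordForm] using h _ (Or.inl (Or.inl (Or.inr ⟨i, rfl⟩)))
      · have h1 := h _ (Or.inl (Or.inr ⟨j, rfl⟩))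
        have h2 := h _ (Or.inr ⟨j, rfl⟩)
        rw [AddMonoidHom.neg_apply] at h2
        rw [lineForm_apply] at h1 h2
        omega
    · rintro ⟨h1, h2, h3⟩ b (((⟨i, rfl⟩ | ⟨i, rfl⟩) | ⟨j, rfl⟩) | ⟨j, rfl⟩)
      · simpa [coordForm] using h1 i
      · simpa [slackForm, coordForm] using h2 i
      · rw [lineForm_apply, h3, sub_self]
      · rw [AddMonoidHom.neg_apply, lineForm_apply, h3, sub_self, neg_zero]
  obtain ⟨q, hq, hqs⟩ := exists_quasiPoly_ncard hB
    (fun i => Or.inl (Or.inl (Or.inl ⟨i, rfl⟩))) (fun i => Or.inl (Or.inl (Or.inr ⟨i, rfl⟩)))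
    hn (x₀ := fun _ => 1) ((hmem _ _).2 ⟨fun _ => by simp, fun _ => by exact_mod_cast hn, by simp⟩)
  obtain ⟨k, hk, hlow⟩ := exists_pow_le_ncard_natLineSums hcov hn
  refine isQuasipolynomialOfDegree_of_growth hq (fun s => ?_) (ncard_natLineSums_le hcov) hk hlow
  rw [← hqs s (Int.natCast_nonneg s)]
  congr 1
  refine Set.ncard_congr (fun x _ i => (x i : ℤ)) ?_ ?_ ?_
  · intro x hx
    refine (hmem _ _).2 ⟨fun i => Int.natCast_nonneg _, fun i => ?_, fun j => ?_⟩
    · exact_mod_cast le_of_mem_natLineSums hcov hx i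
    · exact_mod_cast hx j
  · intro x y _ _ h
    ext i
    exact_mod_cast congrFun h i
  · intro x hx
    obtain ⟨h1, -, h3⟩ := (hmem _ _).1 hx
    lift x to ι → ℕ using h1
    refine ⟨x, fun j => ?_, rfl⟩
    have := h3 j
    beta_reduce at this
    exact_mod_cast this

end

/-! ### The dimension of the space of magic cubes -/

/-- The axial lines of the `n × n × n` cube: the line through `p` in direction `a`. -/
def axialLine (n : ℕ) (l : Fin 3 × (Fin 3 → Fin n)) (k : Fin n) : Fin 3 → Fin n :=
  Function.update l.2 l.1 k

/-- The main diagonals of the `n × n × n` cube. -/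
def diagonalLine (n : ℕ) (ε : Fin 3 → Bool) (k : Fin n) : Fin 3 → Fin n :=
  fun a => if ε a then Fin.rev k else k

/-- The axial lines and the main diagonals of the `n × n × n` cube. -/
def magicLine (n : ℕ) :
    (Fin 3 × (Fin 3 → Fin n)) ⊕ (Fin 3 → Bool) → Fin n → (Fin 3 → Fin n) :=
  Sum.elim (axialLine n) (diagonalLine n)

theorem magicHypercubes_eq_natLineSums (n s : ℕ) :
    magicHypercubes 3 n s = natLineSums (magicLine n) s := by
  ext x
  constructor
  · rintro ⟨h1, h2⟩ (⟨a, p⟩ | ε)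
    · exact h1 a p
    · exact h2 ε
  · intro h
    exact ⟨fun a p => h (Sum.inl (a, p)), fun ε => h (Sum.inr ε)⟩

theorem eq_zero_of_corner_eq_zero {m : ℕ} {x : (Fin 3 → Fin (m + 1)) → ℚ}
    (hx : x ∈ zeroLineSums (axialLine (m + 1)))
    (h : ∀ q : Fin 3 → Fin m, x (fun a => (q a).castSucc) = 0) : x = 0 := by
  have key : ∀ S : Finset (Fin 3), ∀ p : Fin 3 → Fin (m + 1),
      (∀ a, a ∉ S → p a ≠ Fin.last m) → x p = 0 := by
    intro S
    induction S using Finset.induction_on with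
    | empty =>
      intro p hp
      have h1 : p = fun a => ((p a).castPred (hp a (Finset.notMem_empty a))).castSucc := by
        ext a
        simp
      rw [h1]
      exact h _
    | insert a S _ ih =>
      intro p hp
      by_cases ha : p a = Fin.last m
      · have h1 := hx (a, p)
        rw [Fin.sum_univ_castSucc, Finset.sum_eq_zero, zero_add] at h1
        · rwa [axialLine, ← ha, Function.update_eq_self] at h1
        · intro k _
          refine ih _ fun b hb => ?_
          by_cases hba : b = a
          · subst hba
            simp [axialLine, Fin.castSucc_ne_last]
          · simp only [axialLine, Function.update_of_ne hba]
            exact hp b (by simp [hba, hb])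
      · refine ih p fun b hb => ?_
        by_cases hba : b = a
        · rwa [hba]
        · exact hp b (by simp [hba, hb])
  ext p
  exact key Finset.univ p fun a ha => absurd (Finset.mem_univ a) ha

/-- An array with zero axial sums is determined by its restriction to a subcube of side `m`, which
can be prescribed. -/
theorem finrank_zeroLineSums_axialLine (m : ℕ) :
    Module.finrank ℚ (zeroLineSums (axialLine (m + 1))) = m ^ 3 := by
  let ρ : zeroLineSums (axialLine (m + 1)) →ₗ[ℚ] ((Fin 3 → Fin m) → ℚ) :=
    (LinearMap.funLeft ℚ ℚ fun (q : Fin 3 → Fin m) (a : Fin 3) => (q a).castSucc).comp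
      (Submodule.subtype _)
  have hinj : Function.Injective ρ := by
    rw [← LinearMap.ker_eq_bot, LinearMap.ker_eq_bot']
    intro x hx
    exact Subtype.ext (eq_zero_of_corner_eq_zero x.2 fun q => congrFun hx q)
  have hsurj : Function.Surjective ρ := by
    intro g
    let M : Fin m → Fin (m + 1) → ℚ := fun j k =>
      (if k = j.castSucc then 1 else 0) - if k = Fin.last m then 1 else 0
    have hM : ∀ j, ∑ k, M j k = 0 := fun j => by simp [M]
    let x : (Fin 3 → Fin (m + 1)) → ℚ := fun p => ∑ q, g q * ∏ a, M (q a) (p a)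
    have hx : x ∈ zeroLineSums (axialLine (m + 1)) := by
      rintro ⟨a, p⟩
      simp only [x]
      rw [Finset.sum_comm]
      refine Finset.sum_eq_zero fun q _ => ?_
      rw [← Finset.mul_sum]
      have h1 : ∀ k, ∏ b, M (q b) (axialLine (m + 1) (a, p) k b) =
          M (q a) k * ∏ b ∈ Finset.univ.erase a, M (q b) (p b) := by
        intro k
        rw [← Finset.mul_prod_erase _ _ (Finset.mem_univ a)]
        congr 1
        · simp [axialLine]
        · refine Finset.prod_congr rfl fun b hb => ?_
          rw [axialLine, Function.update_of_ne (Finset.ne_of_mem_erase hb)]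
      simp only [h1]
      rw [← Finset.sum_mul, hM, zero_mul, mul_zero]
    refine ⟨⟨x, hx⟩, ?_⟩
    ext q'
    have h2 : ∀ q : Fin 3 → Fin m,
        ∏ a, M (q a) ((q' a).castSucc) = if q' = q then 1 else 0 := by
      intro q
      simp only [M, Fin.castSucc_ne_last, if_false, sub_zero, Fin.castSucc_inj,
        Fintype.prod_boole, funext_iff]
      congr
    change ∑ q, g q * ∏ a, M (q a) ((q' a).castSucc) = g q'
    simp [h2]
  rw [(LinearEquiv.ofBijective ρ ⟨hinj, hsurj⟩).finrank_eq, Module.finrank_fintype_fun_eq_card]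
  simp

theorem finrank_inf_ker {E : Type} [AddCommGroup E] [Module ℚ E] [FiniteDimensional ℚ E]
    (A : Submodule ℚ E) {r : ℕ} (Δ : E →ₗ[ℚ] (Fin r → ℚ)) (h : ∀ t, ∃ x ∈ A, Δ x = t) :
    Module.finrank ℚ (A ⊓ LinearMap.ker Δ : Submodule ℚ E) + r = Module.finrank ℚ A := by
  have h1 := LinearMap.finrank_range_add_finrank_ker (Δ.domRestrict A)
  have h2 : LinearMap.range (Δ.domRestrict A) = ⊤ := by
    rw [LinearMap.range_eq_top]
    intro t
    obtain ⟨x, hx, hxt⟩ := h t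
    exact ⟨⟨x, hx⟩, hxt⟩
  have h3 : (A ⊓ LinearMap.ker Δ : Submodule ℚ E) =
      (LinearMap.ker (Δ.domRestrict A)).map A.subtype := by
    rw [LinearMap.ker_domRestrict, Submodule.map_comap_subtype]
  rw [h2, finrank_top, Module.finrank_fin_fun] at h1
  rw [h3, Submodule.finrank_map_subtype_eq]
  omega

/-- Representatives of the four main diagonals: `0` is `(k, k, k)`, and `j > 0` reverses the
coordinate `j - 1`. -/
def flip (j : Fin 4) : Fin 3 → Bool := fun a => decide (j = a.succ)

/-- The sum over one of the four main diagonals. -/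
def diagonalSum (n : ℕ) (j : Fin 4) : ((Fin 3 → Fin n) → ℚ) →ₗ[ℚ] ℚ :=
  ∑ k, LinearMap.proj (diagonalLine n (flip j) k)

theorem diagonalSum_apply (n : ℕ) (j : Fin 4) (x : (Fin 3 → Fin n) → ℚ) :
    diagonalSum n j x = ∑ k, x (diagonalLine n (flip j) k) := by
  simp [diagonalSum]

theorem mem_zeroLineSums_magicLine {n : ℕ} {x : (Fin 3 → Fin n) → ℚ} :
    x ∈ zeroLineSums (magicLine n) ↔
      x ∈ zeroLineSums (axialLine n) ∧ ∀ j, diagonalSum n j x = 0 := by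
  constructor
  · intro h
    refine ⟨fun l => h (Sum.inl l), fun j => ?_⟩
    rw [diagonalSum_apply]
    exact h (Sum.inr (flip j))
  · rintro ⟨h1, h2⟩ (l | ε)
    · exact h1 l
    · have h3 : ∀ ε : Fin 3 → Bool, ∃ j, ε = flip j ∨ ε = fun a => !flip j a := by decide
      obtain ⟨j, rfl | rfl⟩ := h3 ε
      · exact (diagonalSum_apply n j x).symm.trans (h2 j)
      · rw [← h2 j, diagonalSum_apply, ← Equiv.sum_comp Fin.revPerm]
        refine Finset.sum_congr rfl fun k _ => congrArg x ?_
        ext a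
        simp only [magicLine, Sum.elim_inr, diagonalLine, Fin.revPerm_apply, Fin.rev_rev]
        cases flip j a <;> rfl

/-- The rank one array with the given factors. -/
def tensor {n : ℕ} (f g h : Fin n → ℚ) : (Fin 3 → Fin n) → ℚ :=
  fun p => f (p 0) * g (p 1) * h (p 2)

theorem tensor_mem {n : ℕ} {f g h : Fin n → ℚ} (hf : ∑ k, f k = 0) (hg : ∑ k, g k = 0)
    (hh : ∑ k, h k = 0) : tensor f g h ∈ zeroLineSums (axialLine n) := by
  rintro ⟨a, p⟩
  fin_cases a
  · simp [tensor, axialLine, ← Finset.sum_mul, hf]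
  · simp [tensor, axialLine, ← Finset.sum_mul, ← Finset.mul_sum, hg]
  · simp [tensor, axialLine, ← Finset.mul_sum, hh]

/-- A vector with zero sum, symmetric under reversal. Its cubes sum to zero only for `n = 4`. -/
def symVec (n : ℕ) : Fin (n + 3) → ℚ :=
  fun k => -2 / (n + 1) + (1 + 2 / (n + 1)) *
    ((if k = 0 then 1 else 0) + if k = Fin.last _ then 1 else 0)

/-- A vector with zero sum, antisymmetric under reversal. -/
def antiVec (n : ℕ) : Fin (n + 3) → ℚ :=
  fun k => (if k = 0 then 1 else 0) - if k = Fin.last _ then 1 else 0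

theorem rev_eq_zero_iff {n : ℕ} (k : Fin (n + 1)) : Fin.rev k = 0 ↔ k = Fin.last n := by
  rw [Fin.rev_eq_iff, Fin.rev_zero]

theorem rev_eq_last_iff {n : ℕ} (k : Fin (n + 1)) : Fin.rev k = Fin.last n ↔ k = 0 := by
  rw [Fin.rev_eq_iff, Fin.rev_last]

theorem symVec_rev (n : ℕ) (k : Fin (n + 3)) : symVec n (Fin.rev k) = symVec n k := by
  simp only [symVec, rev_eq_zero_iff, rev_eq_last_iff]
  ring

theorem antiVec_rev (n : ℕ) (k : Fin (n + 3)) : antiVec n (Fin.rev k) = -antiVec n k := by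
  simp only [antiVec, rev_eq_zero_iff, rev_eq_last_iff]
  ring

theorem sum_symVec (n : ℕ) : ∑ k, symVec n k = 0 := by
  simp only [symVec, Finset.sum_add_distrib, ← Finset.mul_sum, Finset.sum_const, Finset.card_univ,
    Fintype.card_fin, Finset.sum_ite_eq', Finset.mem_univ, if_true, nsmul_eq_mul]
  push_cast
  field_simp
  ring

theorem sum_antiVec (n : ℕ) : ∑ k, antiVec n k = 0 := by
  simp [antiVec]

theorem sum_symVec_antiVec_sq (n : ℕ) : ∑ k, symVec n k * antiVec n k * antiVec n k = 2 := by
  have h : ∀ k, symVec n k * antiVec n k * antiVec n k =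
      (if k = 0 then 1 else 0) + if k = Fin.last (n + 2) then 1 else 0 := by
    intro k
    have h0 : (0 : Fin (n + 3)) ≠ Fin.last (n + 2) := Fin.last_pos.ne
    simp only [symVec, antiVec]
    by_cases h1 : k = 0
    · subst h1
      simp only [if_true, if_neg h0]
      ring
    · by_cases h2 : k = Fin.last (n + 2)
      · subst h2
        simp only [if_true, if_neg h1]
        ring
      · simp [h1, h2]
  simp only [h]
  rw [Finset.sum_add_distrib]
  simp
  norm_num

theorem sum_symVec_cube_ne_zero {n : ℕ} (hn : n ≠ 1) :
    ∑ k, symVec n k * symVec n k * symVec n k ≠ 0 := by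
  have h : ∀ k, symVec n k * symVec n k * symVec n k = (-2 / (n + 1)) ^ 3 +
      (1 - (-2 / (n + 1)) ^ 3) *
        ((if k = 0 then 1 else 0) + if k = Fin.last (n + 2) then 1 else 0) := by
    intro k
    have h0 : (0 : Fin (n + 3)) ≠ Fin.last (n + 2) := Fin.last_pos.ne
    simp only [symVec]
    by_cases h1 : k = 0
    · subst h1
      simp only [if_true, if_neg h0]
      ring
    · by_cases h2 : k = Fin.last (n + 2)
      · subst h2
        simp only [if_true, if_neg h1]
        ring
      · simp only [if_neg h1, if_neg h2]
        ring
  simp only [h, Finset.sum_add_distrib, ← Finset.mul_sum, Finset.sum_const, Finset.card_univ,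
    Fintype.card_fin, Finset.sum_ite_eq', Finset.mem_univ, if_true, nsmul_eq_mul]
  have hpos : (n + 1 : ℚ) ≠ 0 := by positivity
  have heq : ((n + 3 : ℕ) : ℚ) * (-2 / (n + 1)) ^ 3 + (1 - (-2 / (n + 1)) ^ 3) * (1 + 1) =
      2 * (n - 1) * (n + 3) / (n + 1) ^ 2 := by
    push_cast
    field_simp
    ring
  rw [heq]
  have h1 : (n - 1 : ℚ) ≠ 0 := by
    rw [sub_ne_zero]
    exact_mod_cast hn
  have h3 : (n + 3 : ℚ) ≠ 0 := by positivity
  positivity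

/-- The diagonal sums of the tensor with symmetric factor `symVec` in direction `a` and
antisymmetric factors `antiVec` in the others: `2` on the diagonal `(k, k, k)` and on the one
reversed in direction `a`, and `-2` on the others. -/
theorem diagonalSum_tensors (n : ℕ) (j : Fin 4) :
    diagonalSum (n + 3) j (tensor (symVec n) (symVec n) (symVec n)) =
      ∑ k, symVec n k * symVec n k * symVec n k ∧
    diagonalSum (n + 3) j (tensor (symVec n) (antiVec n) (antiVec n)) = ![2, 2, -2, -2] j ∧
    diagonalSum (n + 3) j (tensor (antiVec n) (symVec n) (antiVec n)) = ![2, -2, 2, -2] j ∧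
    diagonalSum (n + 3) j (tensor (antiVec n) (antiVec n) (symVec n)) = ![2, -2, -2, 2] j := by
  have h := sum_symVec_antiVec_sq n
  have h1 : ∑ k, antiVec n k * symVec n k * antiVec n k = 2 := by
    rw [← h]
    exact Finset.sum_congr rfl fun _ _ => by ring
  have h2 : ∑ k, antiVec n k * antiVec n k * symVec n k = 2 := by
    rw [← h]
    exact Finset.sum_congr rfl fun _ _ => by ring
  simp only [diagonalSum_apply]
  fin_cases j <;>
    simp [tensor, diagonalLine, flip, symVec_rev, antiVec_rev, h, h1, h2, Fin.ext_iff]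

theorem finrank_zeroLineSums_magicLine {n : ℕ} (hn : n ≠ 1) :
    Module.finrank ℚ (zeroLineSums (magicLine (n + 3))) = (n + 2) ^ 3 - 4 := by
  have h := finrank_inf_ker (zeroLineSums (axialLine (n + 3)))
    (LinearMap.pi (diagonalSum (n + 3))) fun t => by
      have hc := sum_symVec_cube_ne_zero hn
      have hd := diagonalSum_tensors n
      set c := ∑ k, symVec n k * symVec n k * symVec n k
      have hu := sum_symVec n
      have hv := sum_antiVec n
      refine ⟨((t 0 + t 1 + t 2 + t 3) / (4 * c)) • tensor (symVec n) (symVec n) (symVec n) +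
        ((t 0 + t 1 - t 2 - t 3) / 8) • tensor (symVec n) (antiVec n) (antiVec n) +
        ((t 0 - t 1 + t 2 - t 3) / 8) • tensor (antiVec n) (symVec n) (antiVec n) +
        ((t 0 - t 1 - t 2 + t 3) / 8) • tensor (antiVec n) (antiVec n) (symVec n), ?_, ?_⟩
      · refine add_mem (add_mem (add_mem ?_ ?_) ?_) ?_ <;> refine Submodule.smul_mem _ _ ?_
        · exact tensor_mem hu hu hu
        · exact tensor_mem hu hv hv
        · exact tensor_mem hv hu hv
        · exact tensor_mem hv hv hu
      · ext j
        simp only [LinearMap.pi_apply, map_add, map_smul, (hd j).1, (hd j).2.1, (hd j).2.2.1,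
          (hd j).2.2.2, smul_eq_mul]
        fin_cases j <;> simp <;> field_simp <;> ring
  have hW : zeroLineSums (magicLine (n + 3)) = zeroLineSums (axialLine (n + 3)) ⊓
      LinearMap.ker (LinearMap.pi (diagonalSum (n + 3))) := by
    ext x
    rw [mem_zeroLineSums_magicLine, Submodule.mem_inf, LinearMap.mem_ker, funext_iff]
    rfl
  rw [hW, ← Nat.add_sub_cancel (n := Module.finrank ℚ _) (m := 4), h,
    finrank_zeroLineSums_axialLine]

/-- For `n = 4` the cells on the four diagonals are those of two disjoint `2 × 2 × 2` subcubes with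
complementary coordinates. Moving across the axial lines three times exchanges the two subcubes and
changes the sign of the sum over the cells. -/
theorem sum_diagonalSum_four {x : (Fin 3 → Fin 4) → ℚ} (hx : x ∈ zeroLineSums (axialLine 4)) :
    ∑ j, diagonalSum 4 j x = 0 := by
  have h0 : ∀ b c, x ![0, b, c] + x ![1, b, c] + x ![2, b, c] + x ![3, b, c] = 0 := by
    intro b c
    have := hx (0, ![0, b, c])
    rw [Fin.sum_univ_four] at this
    convert this using 4 <;> congr 1 <;> ext i <;> fin_cases i <;> rfl
  have h1 : ∀ a c, x ![a, 0, c] + x ![a, 1, c] + x ![a, 2, c] + x ![a, 3, c] = 0 := by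
    intro a c
    have := hx (1, ![a, 0, c])
    rw [Fin.sum_univ_four] at this
    convert this using 4 <;> congr 1 <;> ext i <;> fin_cases i <;> rfl
  have h2 : ∀ a b, x ![a, b, 0] + x ![a, b, 1] + x ![a, b, 2] + x ![a, b, 3] = 0 := by
    intro a b
    have := hx (2, ![a, b, 0])
    rw [Fin.sum_univ_four] at this
    convert this using 4 <;> congr 1 <;> ext i <;> fin_cases i <;> rfl
  have hl : ∀ (ε : Fin 3 → Bool) (k : Fin 4), diagonalLine 4 ε k =
      ![if ε 0 then Fin.rev k else k, if ε 1 then Fin.rev k else k,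
        if ε 2 then Fin.rev k else k] := by
    intro ε k
    ext i
    fin_cases i <;> rfl
  have hr : Fin.rev (0 : Fin 4) = 3 ∧ Fin.rev (1 : Fin 4) = 2 ∧ Fin.rev (2 : Fin 4) = 1 ∧
    Fin.rev (3 : Fin 4) = 0 := by decide
  have hfl : flip 0 = ![false, false, false] ∧ flip 1 = ![true, false, false] ∧
      flip 2 = ![false, true, false] ∧ flip 3 = ![false, false, true] := by decide
  simp only [Fin.sum_univ_four, diagonalSum_apply, hl, hfl]
  simp [hr]
  linarith [h0 0 0, h0 0 3, h0 3 0, h0 3 3, h1 1 0, h1 1 3, h1 2 0, h1 2 3, h2 1 1, h2 1 2,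
    h2 2 1, h2 2 2]

theorem finrank_zeroLineSums_magicLine_four :
    Module.finrank ℚ (zeroLineSums (magicLine 4)) = 24 := by
  have h := finrank_inf_ker (zeroLineSums (axialLine 4))
    (LinearMap.pi fun i : Fin 3 => diagonalSum 4 i.castSucc) fun t => by
      have hd := diagonalSum_tensors 1
      have hu := sum_symVec 1
      have hv := sum_antiVec 1
      refine ⟨((t 0 + t 1) / 4) • tensor (symVec 1) (antiVec 1) (antiVec 1) +
        ((t 0 + t 2) / 4) • tensor (antiVec 1) (symVec 1) (antiVec 1) +
        (-(t 1 + t 2) / 4) • tensor (antiVec 1) (antiVec 1) (symVec 1), ?_, ?_⟩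
      · refine add_mem (add_mem ?_ ?_) ?_ <;> refine Submodule.smul_mem _ _ ?_
        · exact tensor_mem hu hv hv
        · exact tensor_mem hv hu hv
        · exact tensor_mem hv hv hu
      · ext i
        simp only [LinearMap.pi_apply, map_add, map_smul, (hd _).2.1, (hd _).2.2.1,
          (hd _).2.2.2, smul_eq_mul]
        fin_cases i <;> simp <;> ring
  have hW : zeroLineSums (magicLine 4) = zeroLineSums (axialLine 4) ⊓
      LinearMap.ker (LinearMap.pi fun i : Fin 3 => diagonalSum 4 i.castSucc) := by
    ext x
    rw [mem_zeroLineSums_magicLine, Submodule.mem_inf, LinearMap.mem_ker, funext_iff]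
    refine and_congr_right fun hx => ⟨fun h i => h _, fun h j => ?_⟩
    refine Fin.lastCases ?_ (fun i => h i) j
    have h4 := sum_diagonalSum_four hx
    have h5 : ∑ i : Fin 3, diagonalSum 4 i.castSucc x = 0 := Finset.sum_eq_zero fun i _ => h i
    rw [Fin.sum_univ_castSucc, h5, zero_add] at h4
    exact h4
  rw [← hW, finrank_zeroLineSums_axialLine] at h
  omega

theorem isQuasipolynomialOfDegree_MC {n : ℕ} (hn : 0 < n) :
    IsQuasipolynomialOfDegree (fun s => (MC n s : ℂ))
      (Module.finrank ℚ (zeroLineSums (magicLine n))) := by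
  have hcov : ∀ i, ∃ j k, magicLine n j k = i := fun p =>
    ⟨Sum.inl (0, p), p 0, Function.update_eq_self 0 p⟩
  have h := isQuasipolynomialOfDegree_natLineSums hcov hn
  simpa only [MC, magicHypercubes_eq_natLineSums] using h

/-! ### The magic cubes of side three -/

/-- The four parameters `z` describe a `3 × 3 × 3` magic cube with centre `c`: this is the array of
differences between the entries and `c`. It is antisymmetric under point reflection. With the signs
chosen here, the conditions on `z` are symmetric under permutations of the `z i`. -/
def deviation (z : Fin 4 → ℤ) : Fin 3 → Fin 3 → Fin 3 → ℤ :=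
  ![![![z 0, z 1 - z 0, -z 1],
      ![z 2 - z 0, z 0 + z 3 - z 1 - z 2, z 1 - z 3],
      ![-z 2, z 2 - z 3, z 3]],
    ![![z 3 - z 0, z 0 + z 2 - z 1 - z 3, z 1 - z 2],
      ![z 0 + z 1 - z 2 - z 3, 0, z 2 + z 3 - z 0 - z 1],
      ![z 2 - z 1, z 1 + z 3 - z 0 - z 2, z 0 - z 3]],
    ![![-z 3, z 3 - z 2, z 2],
      ![z 3 - z 1, z 1 + z 2 - z 0 - z 3, z 0 - z 2],
      ![z 1, z 0 - z 1, -z 0]]]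

theorem diagonalLine_three (ε : Fin 3 → Bool) (k : Fin 3) : diagonalLine 3 ε k =
    ![if ε 0 then Fin.rev k else k, if ε 1 then Fin.rev k else k,
      if ε 2 then Fin.rev k else k] := by
  ext i
  fin_cases i <;> rfl

theorem axialLine_three (a b c k : Fin 3) :
    axialLine 3 (0, ![a, b, c]) k = ![k, b, c] ∧ axialLine 3 (1, ![a, b, c]) k = ![a, k, c] ∧
      axialLine 3 (2, ![a, b, c]) k = ![a, b, k] := by
  refine ⟨?_, ?_, ?_⟩ <;> ext i <;> fin_cases i <;> rfl

theorem rev_three : Fin.rev (0 : Fin 3) = 2 ∧ Fin.rev (1 : Fin 3) = 1 ∧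
    Fin.rev (2 : Fin 3) = 0 := by decide

/-- The magic cubes of side three in terms of their entries. -/
theorem mem_magicHypercubes_three {x : (Fin 3 → Fin 3) → ℕ} {s : ℕ} :
    x ∈ magicHypercubes 3 3 s ↔
      (∀ b c, x ![0, b, c] + x ![1, b, c] + x ![2, b, c] = s) ∧
      (∀ a c, x ![a, 0, c] + x ![a, 1, c] + x ![a, 2, c] = s) ∧
      (∀ a b, x ![a, b, 0] + x ![a, b, 1] + x ![a, b, 2] = s) ∧
      x ![0, 0, 0] + x ![1, 1, 1] + x ![2, 2, 2] = s ∧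
      x ![2, 0, 0] + x ![1, 1, 1] + x ![0, 2, 2] = s ∧
      x ![0, 2, 0] + x ![1, 1, 1] + x ![2, 0, 2] = s ∧
      x ![0, 0, 2] + x ![1, 1, 1] + x ![2, 2, 0] = s := by
  rw [magicHypercubes_eq_natLineSums]
  have hdiag : ∀ ε, ∑ k, x (magicLine 3 (Sum.inr ε) k) = ∑ k, x (diagonalLine 3 ε k) :=
    fun _ => rfl
  have hax : ∀ l, ∑ k, x (magicLine 3 (Sum.inl l) k) = ∑ k, x (axialLine 3 l k) :=
    fun _ => rfl
  constructor
  · intro h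
    refine ⟨fun b c => ?_, fun a c => ?_, fun a b => ?_, ?_, ?_, ?_, ?_⟩
    · simpa only [hax, Fin.sum_univ_three, axialLine_three] using h (Sum.inl (0, ![0, b, c]))
    · simpa only [hax, Fin.sum_univ_three, axialLine_three] using h (Sum.inl (1, ![a, 0, c]))
    · simpa only [hax, Fin.sum_univ_three, axialLine_three] using h (Sum.inl (2, ![a, b, 0]))
    · simpa [hdiag, Fin.sum_univ_three, diagonalLine_three, rev_three] using
        h (Sum.inr ![false, false, false])
    · simpa [hdiag, Fin.sum_univ_three, diagonalLine_three, rev_three] using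
        h (Sum.inr ![true, false, false])
    · simpa [hdiag, Fin.sum_univ_three, diagonalLine_three, rev_three] using
        h (Sum.inr ![false, true, false])
    · simpa [hdiag, Fin.sum_univ_three, diagonalLine_three, rev_three] using
        h (Sum.inr ![false, false, true])
  · rintro ⟨h0, h1, h2, d0, d1, d2, d3⟩ (⟨a, p⟩ | ε)
    · obtain ⟨i, j, k, rfl⟩ : ∃ i j k, p = ![i, j, k] :=
        ⟨p 0, p 1, p 2, by ext i; fin_cases i <;> rfl⟩
      rw [hax]
      have ha : a = 0 ∨ a = 1 ∨ a = 2 := by omega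
      rcases ha with rfl | rfl | rfl
      · simpa only [Fin.sum_univ_three, axialLine_three] using h0 j k
      · simpa only [Fin.sum_univ_three, axialLine_three] using h1 i k
      · simpa only [Fin.sum_univ_three, axialLine_three] using h2 i j
    · rw [hdiag]
      simp only [Fin.sum_univ_three, diagonalLine_three]
      cases h0 : ε 0 <;> cases h1 : ε 1 <;> cases h2 : ε 2 <;>
        simp [rev_three] <;> omega

/-- Comparing the sum of the diagonals with the axial sums, the centre is a third of the magic
sum. -/
theorem three_mul_centre {x : (Fin 3 → Fin 3) → ℕ} {s : ℕ} (hx : x ∈ magicHypercubes 3 3 s) :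
    3 * x ![1, 1, 1] = s := by
  obtain ⟨h0, h1, h2, d0, d1, d2, d3⟩ := mem_magicHypercubes_three.1 hx
  linarith [h0 0 0, h0 0 2, h0 2 0, h0 2 2, h1 1 0, h1 1 2, h2 1 1]

/-- The parameters for which all entries of the cube with centre `c` are nonnegative. -/
def paramSet (c : ℕ) : Set (Fin 4 → ℤ) := {z | ∀ i j k, 0 ≤ c + deviation z i j k}

/-- The linear algebra behind `deviation`: the centre and four corners of a magic cube of side three
determine the other entries. -/
theorem eq_centre_add_deviation_of_sums {y : Fin 3 → Fin 3 → Fin 3 → ℤ} {c : ℤ}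
    (h0 : ∀ j k, y 0 j k + y 1 j k + y 2 j k = 3 * c)
    (h1 : ∀ i k, y i 0 k + y i 1 k + y i 2 k = 3 * c)
    (h2 : ∀ i j, y i j 0 + y i j 1 + y i j 2 = 3 * c) (hc : y 1 1 1 = c)
    (d0 : y 0 0 0 + y 1 1 1 + y 2 2 2 = 3 * c) (d1 : y 2 0 0 + y 1 1 1 + y 0 2 2 = 3 * c)
    (d2 : y 0 2 0 + y 1 1 1 + y 2 0 2 = 3 * c) (d3 : y 0 0 2 + y 1 1 1 + y 2 2 0 = 3 * c)
    (i j k : Fin 3) :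
    y i j k = c + deviation ![y 0 0 0 - c, c - y 0 0 2, c - y 0 2 0, y 0 2 2 - c] i j k := by
  have e001 : y 0 0 1 = 3 * c - y 0 0 0 - y 0 0 2 := by linarith only [h2 0 0]
  have e010 : y 0 1 0 = 3 * c - y 0 0 0 - y 0 2 0 := by linarith only [h1 0 0]
  have e012 : y 0 1 2 = 3 * c - y 0 0 2 - y 0 2 2 := by linarith only [h1 0 2]
  have e021 : y 0 2 1 = 3 * c - y 0 2 0 - y 0 2 2 := by linarith only [h2 0 2]
  have e011 : y 0 1 1 = -3 * c + y 0 0 0 + y 0 2 0 + y 0 0 2 + y 0 2 2 := by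
    linarith only [h2 0 1, e010, e012]
  have e222 : y 2 2 2 = 2 * c - y 0 0 0 := by linarith only [d0, hc]
  have e200 : y 2 0 0 = 2 * c - y 0 2 2 := by linarith only [d1, hc]
  have e202 : y 2 0 2 = 2 * c - y 0 2 0 := by linarith only [d2, hc]
  have e220 : y 2 2 0 = 2 * c - y 0 0 2 := by linarith only [d3, hc]
  have e201 : y 2 0 1 = -c + y 0 2 2 + y 0 2 0 := by linarith only [h2 2 0, e200, e202]
  have e210 : y 2 1 0 = -c + y 0 2 2 + y 0 0 2 := by linarith only [h1 2 0, e200, e220]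
  have e212 : y 2 1 2 = -c + y 0 2 0 + y 0 0 0 := by linarith only [h1 2 2, e202, e222]
  have e221 : y 2 2 1 = -c + y 0 0 2 + y 0 0 0 := by linarith only [h2 2 2, e220, e222]
  have e211 : y 2 1 1 = 5 * c - y 0 0 0 - y 0 2 0 - y 0 0 2 - y 0 2 2 := by
    linarith only [h2 2 1, e210, e212]
  fin_cases i
  · fin_cases j <;> fin_cases k <;> simp [deviation, e001, e010, e011, e012, e021] <;> ring
  · have e (j k : Fin 3) : y 1 j k = 3 * c - y 0 j k - y 2 j k := by linarith only [h0 j k]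
    fin_cases j <;> fin_cases k <;>
      simp [deviation, e, e001, e010, e011, e012, e021, e222, e200, e202, e220, e201, e210, e212,
        e221, e211] <;> ring
  · fin_cases j <;> fin_cases k <;> simp [deviation, e222, e200, e202, e220, e201, e210, e212,
        e221, e211] <;> ring

theorem eq_centre_add_deviation {x : (Fin 3 → Fin 3) → ℕ} {c : ℕ}
    (hx : x ∈ magicHypercubes 3 3 (3 * c)) (i j k : Fin 3) :
    (x ![i, j, k] : ℤ) = c + deviation ![x ![0, 0, 0] - c, c - x ![0, 0, 2], c - x ![0, 2, 0],
      x ![0, 2, 2] - c] i j k := by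
  have hc := three_mul_centre hx
  have hc' : (x ![1, 1, 1] : ℤ) = c := by omega
  have h := mem_magicHypercubes_three.1 hx
  zify at h
  obtain ⟨h0, h1, h2, d0, d1, d2, d3⟩ := h
  exact eq_centre_add_deviation_of_sums (y := fun i j k => (x ![i, j, k] : ℤ)) h0 h1 h2 hc' d0 d1
    d2 d3 i j k

theorem MC_three_mul (c : ℕ) : MC 3 (3 * c) = (paramSet c).ncard := by
  refine Set.ncard_congr (fun x _ => ![x ![0, 0, 0] - c, c - x ![0, 0, 2], c - x ![0, 2, 0],
      x ![0, 2, 2] - c]) ?_ ?_ ?_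
  · intro x hx i j k
    rw [← eq_centre_add_deviation hx]
    exact Int.natCast_nonneg _
  · intro x y hx hy h
    ext p
    obtain ⟨i, j, k, rfl⟩ : ∃ i j k, p = ![i, j, k] :=
      ⟨p 0, p 1, p 2, by ext i; fin_cases i <;> rfl⟩
    have h1 := eq_centre_add_deviation hx i j k
    rw [h, ← eq_centre_add_deviation hy] at h1
    exact_mod_cast h1
  · intro z hz
    have hx : ∀ i j k, ((((c : ℤ) + deviation z i j k).toNat : ℕ) : ℤ) = c + deviation z i j k :=
      fun i j k => Int.toNat_of_nonneg (hz i j k)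
    refine ⟨fun p => ((c : ℤ) + deviation z (p 0) (p 1) (p 2)).toNat, ?_, ?_⟩
    · rw [mem_magicHypercubes_three]
      zify
      simp only [Matrix.cons_val_zero, Matrix.cons_val_one, Matrix.cons_val, hx]
      refine ⟨?_, ?_, ?_, ?_⟩
      · intro i j
        fin_cases i <;> fin_cases j <;> simp [deviation] <;> ring
      · intro i j
        fin_cases i <;> fin_cases j <;> simp [deviation] <;> ring
      · intro i j
        fin_cases i <;> fin_cases j <;> simp [deviation] <;> ring
      · simp [deviation]
        refine ⟨?_, ?_, ?_, ?_⟩ <;> ring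
    · ext i
      simp only [Matrix.cons_val_zero, Matrix.cons_val_one, Matrix.cons_val, hx]
      fin_cases i <;> simp [deviation]

/-- The inequalities cutting out `paramSet c`, in a form that shows their symmetry. -/
theorem mem_paramSet {c : ℕ} {z : Fin 4 → ℤ} : z ∈ paramSet c ↔
    (∀ i, -c ≤ z i ∧ z i ≤ c) ∧ ∀ i j, i ≠ j → 2 * (z i + z j) - ∑ l, z l ≤ c := by
  simp only [paramSet, Set.mem_ofPred_eq, Fin.sum_univ_four]
  constructor
  · intro h
    have a1 := h 0 0 0
    have a2 := h 0 0 2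
    have a3 := h 0 2 0
    have a4 := h 0 2 2
    have a5 := h 2 0 0
    have a6 := h 2 0 2
    have a7 := h 2 2 0
    have a8 := h 2 2 2
    have b1 := h 0 1 1
    have b2 := h 1 0 1
    have b3 := h 1 1 0
    have b4 := h 2 1 1
    have b5 := h 1 2 1
    have b6 := h 1 1 2
    clear h
    simp [deviation] at a1 a2 a3 a4 a5 a6 a7 a8 b1 b2 b3 b4 b5 b6
    refine ⟨fun i => ?_, fun i j hij => ?_⟩
    · fin_cases i <;> simp <;> omega
    · fin_cases i <;> fin_cases j <;> simp at hij ⊢ <;> omega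
  · rintro ⟨h1, h2⟩
    have a1 := h1 0
    have a2 := h1 1
    have a3 := h1 2
    have a4 := h1 3
    have b1 := h2 0 1 (by decide)
    have b2 := h2 0 2 (by decide)
    have b3 := h2 0 3 (by decide)
    have b4 := h2 1 2 (by decide)
    have b5 := h2 1 3 (by decide)
    have b6 := h2 2 3 (by decide)
    clear h1 h2
    intro i j k
    fin_cases i <;> fin_cases j <;> fin_cases k <;> simp [deviation] <;> omega

theorem comp_mem_paramSet {c : ℕ} {z : Fin 4 → ℤ} (hz : z ∈ paramSet c)
    (σ : Equiv.Perm (Fin 4)) : z ∘ σ ∈ paramSet c := by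
  rw [mem_paramSet] at hz ⊢
  refine ⟨fun i => hz.1 _, fun i j hij => ?_⟩
  have := hz.2 (σ i) (σ j) (σ.injective.ne hij)
  rwa [← Equiv.sum_comp σ] at this

theorem monotone_fin_four {g : Fin 4 → ℤ} : Monotone g ↔ g 0 ≤ g 1 ∧ g 1 ≤ g 2 ∧ g 2 ≤ g 3 := by
  rw [Fin.monotone_iff_le_succ]
  constructor
  · intro h
    exact ⟨h 0, h 1, h 2⟩
  · rintro ⟨h0, h1, h2⟩ i
    fin_cases i
    · exact h0
    · exact h1
    · exact h2

theorem mem_paramSet_of_monotone {c : ℕ} {g : Fin 4 → ℤ} (hg : Monotone g) :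
    g ∈ paramSet c ↔ -c ≤ g 0 ∧ g 3 ≤ c ∧ g 2 + g 3 - g 0 - g 1 ≤ c := by
  obtain ⟨h0, h1, h2⟩ := monotone_fin_four.1 hg
  rw [mem_paramSet, Fin.sum_univ_four]
  constructor
  · rintro ⟨h3, h4⟩
    have a1 := h3 0
    have a2 := h3 3
    have a3 := h4 2 3 (by decide)
    refine ⟨a1.1, a2.2, ?_⟩
    linarith
  · rintro ⟨a1, a2, a3⟩
    refine ⟨fun i => ?_, fun i j hij => ?_⟩
    · fin_cases i <;> simp <;> omega
    · fin_cases i <;> fin_cases j <;> simp at hij ⊢ <;> omega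

theorem paramSet_finite (c : ℕ) : (paramSet c).Finite :=
  (Set.Finite.pi' fun _ : Fin 4 => Set.finite_Icc (-(c : ℤ)) c).subset
    fun _ hz => (mem_paramSet.1 hz).1

/-- For monotone `g`, the condition that `σ` is the sorting permutation `Tuple.sort` of the
rearrangement `g ∘ σ⁻¹` of `g`: ties are broken by index. -/
def IsSortOf (g : Fin 4 → ℤ) (σ : Equiv.Perm (Fin 4)) : Prop :=
  ∀ i j, i < j → g i = g j → σ i < σ j

open scoped Classical in
/-- Every tuple is a rearrangement of a unique monotone tuple `g`, and the number of rearrangements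
of `g` is the number of permutations that occur as sorting permutations. -/
theorem ncard_paramSet (c : ℕ) : (paramSet c).ncard =
    ∑ g ∈ (paramSet_finite c).toFinset with Monotone g,
      (Finset.univ.filter (IsSortOf g)).card := by
  rw [Set.ncard_eq_toFinset_card _ (paramSet_finite c)]
  have h1 := Finset.card_eq_sum_card_fiberwise (f := Tuple.sort)
    (s := (paramSet_finite c).toFinset) (t := Finset.univ) fun _ _ => Finset.mem_univ _
  have h2 : ∀ σ : Equiv.Perm (Fin 4),
      ((paramSet_finite c).toFinset.filter fun z => Tuple.sort z = σ).card =
      (((paramSet_finite c).toFinset.filter Monotone).filter fun g => IsSortOf g σ).card := by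
    intro σ
    refine Finset.card_bij' (fun z _ => z ∘ σ) (fun g _ => g ∘ σ.symm) ?_ ?_ ?_ ?_
    · intro z hz
      simp only [Finset.mem_filter, Set.Finite.mem_toFinset] at hz ⊢
      obtain ⟨h3, h4⟩ := Tuple.eq_sort_iff.1 hz.2.symm
      exact ⟨⟨comp_mem_paramSet hz.1 σ, h3⟩, h4⟩
    · intro g hg
      simp only [Finset.mem_filter, Set.Finite.mem_toFinset] at hg ⊢
      refine ⟨comp_mem_paramSet hg.1.1 σ.symm, (Tuple.eq_sort_iff.2 ⟨?_, ?_⟩).symm⟩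
      · convert hg.1.2 using 1
        ext i
        simp
      · intro i j hij h
        simp only [Function.comp_apply, Equiv.symm_apply_apply] at h
        exact hg.2 i j hij h
    · intro z _
      ext i
      simp
    · intro g _
      ext i
      simp
  rw [h1]
  simp only [h2, Finset.card_filter]
  rw [Finset.sum_comm]

/-- The number of rearrangements of a monotone quadruple, where `p`, `q`, `r` tell which of its
gaps vanish. -/
def rearrangements (p q r : Bool) : ℕ :=
  (Finset.univ.filter fun σ : Equiv.Perm (Fin 4) =>
    (p = true → σ 0 < σ 1) ∧ (q = true → σ 1 < σ 2) ∧ (r = true → σ 2 < σ 3)).card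

theorem isSortOf_iff {g : Fin 4 → ℤ} (hg : Monotone g) (σ : Equiv.Perm (Fin 4)) :
    IsSortOf g σ ↔ (g 0 = g 1 → σ 0 < σ 1) ∧ (g 1 = g 2 → σ 1 < σ 2) ∧
      (g 2 = g 3 → σ 2 < σ 3) := by
  obtain ⟨h0, h1, h2⟩ := monotone_fin_four.1 hg
  constructor
  · intro h
    exact ⟨h 0 1 (by decide), h 1 2 (by decide), h 2 3 (by decide)⟩
  · rintro ⟨a, b, d⟩ i j hij h
    fin_cases i <;> fin_cases j <;> simp at hij h ⊢
    · exact a h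
    · exact (a (by omega)).trans (b (by omega))
    · exact (a (by omega)).trans ((b (by omega)).trans (d (by omega)))
    · exact b h
    · exact (b (by omega)).trans (d (by omega))
    · exact d h

theorem rearrangements_eq (p q r : Bool) :
    rearrangements p q r =
      if q then (if p then (if r then 1 else 4) else (if r then 4 else 12))
      else (if p then (if r then 6 else 12) else (if r then 12 else 24)) := by
  revert p q r
  decide +kernel

/-- The number of rearrangements, summed over the pairs of outer gaps `α`, `u - α` with sum `u`. -/
theorem sum_rearrangements (β u : ℕ) :
    ((∑ α ∈ Finset.range (u + 1),
      rearrangements (decide (α = 0)) (decide (β = 0)) (decide (u - α = 0)) : ℕ) : ℤ) =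
      if β = 0 then 12 * (u : ℤ) - 4 + (if u = 0 then 5 else 0)
      else 24 * (u : ℤ) + if u = 0 then 6 else 0 := by
  rcases u with _ | u
  · by_cases hβ : β = 0 <;> simp [hβ, rearrangements_eq]
  · rw [Finset.sum_range_succ, Finset.sum_range_succ']
    have h : ∀ α ∈ Finset.range u, rearrangements (decide (α + 1 = 0)) (decide (β = 0))
        (decide (u + 1 - (α + 1) = 0)) = if β = 0 then 12 else 24 := by
      intro α hα
      rw [Finset.mem_range] at hα
      rw [rearrangements_eq, decide_eq_false (by omega : ¬ α + 1 = 0),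
        decide_eq_false (by omega : ¬ u + 1 - (α + 1) = 0)]
      simp
    rw [Finset.sum_congr rfl h]
    by_cases hβ : β = 0 <;> simp [hβ, rearrangements_eq] <;> ring

/-- The monotone quadruple with first entry `t`, first gap `α`, middle gap `β` and outer gaps adding
up to `u`. -/
def quadruple (w : (_ : ℕ) × (_ : ℕ) × (_ : ℕ) × ℤ) : Fin 4 → ℤ :=
  ![w.2.2.2, w.2.2.2 + w.2.2.1, w.2.2.2 + w.2.2.1 + w.2.1, w.2.2.2 + w.1 + w.2.1]

/-- The index set of the monotone quadruples in `paramSet c`: the sum `u` of the outer gaps, the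
middle gap `β`, the first gap and the first entry. -/
noncomputable def gapIndex (c : ℕ) : Finset ((_ : ℕ) × (_ : ℕ) × (_ : ℕ) × ℤ) :=
  (Finset.range (c + 1)).sigma fun u => (Finset.range ((c - u) / 2 + 1)).sigma fun β =>
    (Finset.range (u + 1)).sigma fun _ => Finset.Icc (-(c : ℤ)) (c - u - β)

theorem ncard_paramSet_eq_sum_gapIndex (c : ℕ) : (paramSet c).ncard =
    ∑ w ∈ gapIndex c, rearrangements (decide (w.2.2.1 = 0)) (decide (w.2.1 = 0))
      (decide (w.1 - w.2.2.1 = 0)) := by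
  classical
  rw [ncard_paramSet]
  symm
  refine Finset.sum_bij (fun w _ => quadruple w) ?_ ?_ ?_ ?_
  · rintro ⟨u, β, α, t⟩ h
    simp only [gapIndex, Finset.mem_sigma, Finset.mem_range, Finset.mem_Icc] at h
    have hm : Monotone (quadruple ⟨u, β, α, t⟩) := by
      rw [monotone_fin_four]
      simp [quadruple]
      omega
    rw [Finset.mem_filter, Set.Finite.mem_toFinset, mem_paramSet_of_monotone hm]
    refine ⟨?_, hm⟩
    simp [quadruple]
    omega
  · rintro ⟨u, β, α, t⟩ h ⟨u', β', α', t'⟩ h' heq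
    simp only [gapIndex, Finset.mem_sigma, Finset.mem_range, Finset.mem_Icc] at h h'
    have h0 := congrFun heq 0
    have h1 := congrFun heq 1
    have h2 := congrFun heq 2
    have h3 := congrFun heq 3
    simp [quadruple] at h0 h1 h2 h3
    obtain rfl : t = t' := h0
    obtain rfl : α = α' := by omega
    obtain rfl : β = β' := by omega
    obtain rfl : u = u' := by omega
    rfl
  · intro g hg
    rw [Finset.mem_filter, Set.Finite.mem_toFinset] at hg
    obtain ⟨hg, hm⟩ := hg
    rw [mem_paramSet_of_monotone hm] at hg
    rw [monotone_fin_four] at hm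
    refine ⟨⟨((g 1 - g 0) + (g 3 - g 2)).toNat, (g 2 - g 1).toNat, (g 1 - g 0).toNat, g 0⟩,
      ?_, ?_⟩
    · simp only [gapIndex, Finset.mem_sigma, Finset.mem_range, Finset.mem_Icc]
      omega
    · ext i
      fin_cases i <;> simp [quadruple] <;> omega
  · rintro ⟨u, β, α, t⟩ h
    simp only [gapIndex, Finset.mem_sigma, Finset.mem_range, Finset.mem_Icc] at h
    have hm : Monotone (quadruple ⟨u, β, α, t⟩) := by
      rw [monotone_fin_four]
      simp [quadruple]
      omega
    unfold rearrangements
    congr 1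
    ext σ
    rw [Finset.mem_filter, Finset.mem_filter, isSortOf_iff hm]
    have e1 : quadruple ⟨u, β, α, t⟩ 0 = quadruple ⟨u, β, α, t⟩ 1 ↔ α = 0 := by
      simp [quadruple]
    have e2 : quadruple ⟨u, β, α, t⟩ 1 = quadruple ⟨u, β, α, t⟩ 2 ↔ β = 0 := by
      simp [quadruple]
    have e3 : quadruple ⟨u, β, α, t⟩ 2 = quadruple ⟨u, β, α, t⟩ 3 ↔ u - α = 0 := by
      simp [quadruple]
      omega
    rw [e1, e2, e3]
    simp

/-- The generic summand of the count, for outer gaps adding up to `u` and middle gaps up to `k`. -/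
def gapTerm (c u k : ℤ) : ℤ :=
  (2 * c + 1 - u) * (12 * u - 4) + 24 * u * k * (2 * c + 1 - u) - 12 * u * k * (k + 1)

theorem sum_gapTerm (c : ℤ) (m : ℕ) :
    ∑ v ∈ Finset.range (2 * m), gapTerm c (c - v) ((v / 2 : ℕ) : ℤ) =
      4 * m ^ 2 - 4 * m ^ 3 - 36 * m ^ 4 + c * (24 * m ^ 2 - 8 * m ^ 3) + 24 * c ^ 2 * m ^ 2 := by
  induction m with
  | zero => simp
  | succ m ih =>
    rw [show 2 * (m + 1) = 2 * m + 1 + 1 by ring, Finset.sum_range_succ, Finset.sum_range_succ, ih,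
      show (2 * m + 1) / 2 = m by omega, show 2 * m / 2 = m by omega]
    simp only [gapTerm]
    push_cast
    ring

/-- The number of parameters, with `v = c - u` as the variable of summation. The summand `gapTerm`
is wrong for `u = 0`, where all outer gaps vanish; the last bracket corrects this. -/
theorem ncard_paramSet_eq_sum_gapTerm (c : ℕ) : ((paramSet c).ncard : ℤ) =
    ∑ v ∈ Finset.range (c + 1), gapTerm c (c - v) ((v / 2 : ℕ) : ℤ) +
      (5 * (2 * c + 1) + 6 * ((c / 2 : ℕ) : ℤ) * (2 * c + 1) -
        3 * ((c / 2 : ℕ) : ℤ) * (((c / 2 : ℕ) : ℤ) + 1)) := by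
  have hβ : ∀ (E : ℤ) (w₀ w₁ : ℤ) (k : ℕ),
      2 * ∑ β ∈ Finset.range (k + 1), (E - β) * (if β = 0 then w₀ else w₁) =
        2 * E * w₀ + w₁ * (2 * k * E - k * (k + 1)) := by
    intro E w₀ w₁ k
    induction k with
    | zero => simp; ring
    | succ k ih =>
      rw [Finset.sum_range_succ, mul_add, ih, if_neg (by omega)]
      push_cast
      ring
  have h1 : ∀ u ∈ Finset.range (c + 1), ((∑ w ∈ (Finset.range ((c - u) / 2 + 1)).sigma fun β =>
      (Finset.range (u + 1)).sigma fun _ => Finset.Icc (-(c : ℤ)) (c - u - β),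
        rearrangements (decide (w.2.1 = 0)) (decide (w.1 = 0)) (decide (u - w.2.1 = 0)) : ℕ) : ℤ) =
      gapTerm c u (((c - u) / 2 : ℕ) : ℤ) + if u = 0 then
        (5 * (2 * c + 1) + 6 * ((c / 2 : ℕ) : ℤ) * (2 * c + 1) -
        3 * ((c / 2 : ℕ) : ℤ) * (((c / 2 : ℕ) : ℤ) + 1)) else 0 := by
    intro u hu
    rw [Finset.mem_range] at hu
    have h2 : ∀ β ∈ Finset.range ((c - u) / 2 + 1),
        ((∑ w ∈ (Finset.range (u + 1)).sigma fun _ => Finset.Icc (-(c : ℤ)) (c - u - β),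
          rearrangements (decide (w.1 = 0)) (decide (β = 0)) (decide (u - w.1 = 0)) : ℕ) : ℤ) =
        ((2 * c + 1 - u : ℤ) - β) * if β = 0 then 12 * (u : ℤ) - 4 + (if u = 0 then 5 else 0)
          else 24 * (u : ℤ) + if u = 0 then 6 else 0 := by
      intro β hβ
      rw [Finset.mem_range] at hβ
      rw [← sum_rearrangements, Finset.sum_sigma]
      refine (congrArg Nat.cast (Finset.sum_congr rfl fun α _ => Finset.sum_const
        (rearrangements (decide (α = 0)) (decide (β = 0)) (decide (u - α = 0))))).trans ?_
      simp only [Int.card_Icc, smul_eq_mul]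
      rw [← Finset.mul_sum]
      push_cast
      congr 1
      omega
    rw [Finset.sum_sigma, Nat.cast_sum, Finset.sum_congr rfl h2]
    have h3 := hβ (2 * c + 1 - u) (12 * (u : ℤ) - 4 + (if u = 0 then 5 else 0))
      (24 * (u : ℤ) + if u = 0 then 6 else 0) ((c - u) / 2)
    refine mul_left_cancel₀ (two_ne_zero (α := ℤ)) (h3.trans ?_)
    by_cases hu0 : u = 0
    · subst hu0
      simp [gapTerm]
      ring
    · simp only [if_neg hu0, gapTerm]
      ring
  rw [ncard_paramSet_eq_sum_gapIndex, gapIndex, Finset.sum_sigma, Nat.cast_sum,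
    Finset.sum_congr rfl h1, Finset.sum_add_distrib, Finset.sum_ite_eq', if_pos (by simp)]
  congr 1
  rw [← Finset.sum_range_reflect]
  refine Finset.sum_congr rfl fun v hv => ?_
  rw [Finset.mem_range] at hv
  rw [show c + 1 - 1 - v = c - v by omega, show c - (c - v) = v by omega, Nat.cast_sub (by omega)]

/-- The number of magic cubes of side three with centre `c`. -/
theorem four_mul_MC_three (c : ℕ) :
    4 * (MC 3 (3 * c) : ℤ) = 11 * c ^ 4 + 22 * c ^ 3 + 25 * c ^ 2 + 14 * c + 4 := by
  rw [MC_three_mul, ncard_paramSet_eq_sum_gapTerm]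
  obtain ⟨m, rfl | rfl⟩ := Nat.even_or_odd' c
  · rw [Finset.sum_range_succ, sum_gapTerm, show 2 * m / 2 = m by omega]
    simp only [gapTerm]
    push_cast
    ring
  · rw [show 2 * m + 1 + 1 = 2 * (m + 1) by ring, sum_gapTerm, show (2 * m + 1) / 2 = m by omega]
    push_cast
    ring

theorem MC_three_of_not_dvd {s : ℕ} (hs : ¬ 3 ∣ s) : MC 3 s = 0 := by
  rw [MC, Set.ncard_eq_zero (magicHypercubes_three_finite 3 s), Set.eq_empty_iff_forall_notMem]
  exact fun x hx => hs ⟨_, (three_mul_centre hx).symm⟩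

theorem MC_three_eq (s : ℕ) : (MC 3 s : ℚ) =
    if 3 ∣ s then
      11 / 324 * (s : ℚ) ^ 4 + 11 / 54 * (s : ℚ) ^ 3 + 25 / 36 * (s : ℚ) ^ 2 + 7 / 6 * (s : ℚ) + 1
    else 0 := by
  split_ifs with h
  · obtain ⟨c, rfl⟩ := h
    have h1 : (4 * (MC 3 (3 * c) : ℚ)) = 11 * c ^ 4 + 22 * c ^ 3 + 25 * c ^ 2 + 14 * c + 4 := by
      exact_mod_cast four_mul_MC_three c
    push_cast
    linarith
  · rw [MC_three_of_not_dvd h, Nat.cast_zero]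

theorem mk_mul_one_sub_X_cube (a : ℕ → ℚ) :
    PowerSeries.mk a * (1 - PowerSeries.X ^ 3) =
      PowerSeries.mk fun n => a n - if 3 ≤ n then a (n - 3) else 0 := by
  ext n
  rw [mul_sub, mul_one, map_sub, PowerSeries.coeff_mul_X_pow']
  simp only [PowerSeries.coeff_mk]

theorem mk_MC_three : PowerSeries.mk (fun s => (MC 3 s : ℚ)) =
    ((PowerSeries.X : PowerSeries ℚ) ^ 12 + 14 * PowerSeries.X ^ 9 + 36 * PowerSeries.X ^ 6
      + 14 * PowerSeries.X ^ 3 + 1) * ((1 - PowerSeries.X ^ 3) ^ 5)⁻¹ := by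
  rw [PowerSeries.eq_mul_inv_iff_mul_eq (by simp)]
  have h14 : (14 : PowerSeries ℚ) = PowerSeries.C 14 := (map_ofNat PowerSeries.C 14).symm
  have h36 : (36 : PowerSeries ℚ) = PowerSeries.C 36 := (map_ofNat PowerSeries.C 36).symm
  simp only [pow_succ (1 - PowerSeries.X ^ 3 : PowerSeries ℚ), pow_zero, one_mul, ← mul_assoc,
    mk_mul_one_sub_X_cube]
  ext n
  rw [h14, h36]
  simp only [PowerSeries.coeff_mk, map_add, PowerSeries.coeff_C_mul, PowerSeries.coeff_X_pow,
    PowerSeries.coeff_one, MC_three_eq]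
  rcases lt_or_ge n 15 with hn | hn
  · interval_cases n <;> norm_num
  · obtain ⟨m, rfl⟩ := Nat.exists_eq_add_of_le' hn
    have h3 : (3 ∣ m + 15 ↔ 3 ∣ m) ∧ (3 ∣ m + 12 ↔ 3 ∣ m) ∧ (3 ∣ m + 9 ↔ 3 ∣ m) ∧
        (3 ∣ m + 6 ↔ 3 ∣ m) ∧ (3 ∣ m + 3 ↔ 3 ∣ m) := by omega
    have e1 : m + 15 - 3 = m + 12 := rfl
    have e2 : m + 12 - 3 = m + 9 := rfl
    have e3 : m + 9 - 3 = m + 6 := rfl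
    have e4 : m + 6 - 3 = m + 3 := rfl
    have e5 : m + 3 - 3 = m := rfl
    simp only [e1, e2, e3, e4, e5, h3, if_pos (by omega : 3 ≤ m + 15),
      if_pos (by omega : 3 ≤ m + 12), if_pos (by omega : 3 ≤ m + 9), if_pos (by omega : 3 ≤ m + 6),
      if_pos (by omega : 3 ≤ m + 3), if_neg (by omega : ¬ m + 15 = 12),
      if_neg (by omega : ¬ m + 15 = 9), if_neg (by omega : ¬ m + 15 = 6),
      if_neg (by omega : ¬ m + 15 = 3), if_neg (by omega : ¬ m + 15 = 0)]
    split_ifs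
    · push_cast
      ring
    · ring

/-! ### The polytope of stochastic magic hypercubes of side three and dimension four -/

theorem update_four (i j k l t : Fin 3) :
    Function.update ![i, j, k, l] 0 t = ![t, j, k, l] ∧
    Function.update ![i, j, k, l] 1 t = ![i, t, k, l] ∧
    Function.update ![i, j, k, l] 2 t = ![i, j, t, l] ∧
    Function.update ![i, j, k, l] 3 t = ![i, j, k, t] := by
  refine ⟨?_, ?_, ?_, ?_⟩ <;> ext a <;> fin_cases a <;> rfl

/-- The centre of a stochastic magic hypercube is `1 / 3`: the diagonals pass eight times through
the centre and once through each corner, and the axial sums express the sum of the corners by the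
centre. -/
theorem centre_eq_third {x : (Fin 4 → Fin 3) → ℝ} (hx : x ∈ stochasticMagicPolytope 4 3) :
    x ![1, 1, 1, 1] = 1 / 3 := by
  obtain ⟨-, hax, hdiag⟩ := hx
  have h0 : ∀ j k l, x ![0, j, k, l] + x ![1, j, k, l] + x ![2, j, k, l] = 1 := fun j k l => by
    simpa only [Fin.sum_univ_three, update_four] using hax 0 ![0, j, k, l]
  have h1 : ∀ i k l, x ![i, 0, k, l] + x ![i, 1, k, l] + x ![i, 2, k, l] = 1 := fun i k l => by
    simpa only [Fin.sum_univ_three, update_four] using hax 1 ![i, 0, k, l]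
  have h2 : ∀ i j l, x ![i, j, 0, l] + x ![i, j, 1, l] + x ![i, j, 2, l] = 1 := fun i j l => by
    simpa only [Fin.sum_univ_three, update_four] using hax 2 ![i, j, 0, l]
  have h3 : ∀ i j k, x ![i, j, k, 0] + x ![i, j, k, 1] + x ![i, j, k, 2] = 1 := fun i j k => by
    simpa only [Fin.sum_univ_three, update_four] using hax 3 ![i, j, k, 0]
  have hd : ∀ ε₀ ε₁ ε₂ ε₃ : Bool,
      x ![if ε₀ then 2 else 0, if ε₁ then 2 else 0, if ε₂ then 2 else 0, if ε₃ then 2 else 0] +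
        x ![1, 1, 1, 1] +
        x ![if ε₀ then 0 else 2, if ε₁ then 0 else 2, if ε₂ then 0 else 2, if ε₃ then 0 else 2]
        = 1 := by
    intro ε₀ ε₁ ε₂ ε₃
    rw [← hdiag ![ε₀, ε₁, ε₂, ε₃], Fin.sum_univ_three]
    congr 1
    · congr 1 <;> congr 1 <;> ext a <;> fin_cases a <;> simp [rev_three]
    · congr 1
      ext a
      fin_cases a <;> simp [rev_three]
  have d0 := hd false false false false
  have d1 := hd true false false false
  have d2 := hd false true false false
  have d3 := hd true true false false
  have d4 := hd false false true false
  have d5 := hd true false true false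
  have d6 := hd false true true false
  have d7 := hd true true true false
  simp only [if_true, Bool.false_eq_true, if_false] at d0 d1 d2 d3 d4 d5 d6 d7
  linarith only [d0, d1, d2, d3, d4, d5, d6, d7, h0 0 0 0, h0 0 0 2, h0 0 2 0, h0 0 2 2, h0 2 0 0,
    h0 2 0 2, h0 2 2 0, h0 2 2 2, h1 1 0 0, h1 1 0 2, h1 1 2 0, h1 1 2 2, h2 1 1 0, h2 1 1 2,
    h3 1 1 1]

theorem isCompact_stochasticMagicPolytope {d n : ℕ} (hd : 0 < d) :
    IsCompact (stochasticMagicPolytope d n) := by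
  refine (isCompact_univ_pi fun _ : Fin d → Fin n =>
    isCompact_Icc (a := (0 : ℝ)) (b := 1)).of_isClosed_subset ?_ ?_
  · have h1 : IsClosed {x : (Fin d → Fin n) → ℝ | ∀ p, 0 ≤ x p} := by
      simp only [Set.ofPred_forall]
      exact isClosed_iInter fun p => isClosed_le continuous_const (continuous_apply p)
    have h2 : IsClosed {x : (Fin d → Fin n) → ℝ | HasAxialSums x 1} := by
      simp only [HasAxialSums, Set.ofPred_forall]
      exact isClosed_iInter fun a => isClosed_iInter fun p =>
        isClosed_eq (continuous_finsetSum _ fun k _ => continuous_apply _) continuous_const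
    have h3 : IsClosed {x : (Fin d → Fin n) → ℝ | HasDiagonalSums x 1} := by
      simp only [HasDiagonalSums, Set.ofPred_forall]
      exact isClosed_iInter fun ε =>
        isClosed_eq (continuous_finsetSum _ fun k _ => continuous_apply _) continuous_const
    exact h1.inter (h2.inter h3)
  · rintro x ⟨h1, h2, -⟩ p -
    refine ⟨h1 p, ?_⟩
    have h3 := Finset.single_le_sum (f := fun k => x (Function.update p ⟨0, hd⟩ k))
      (fun _ _ => h1 _) (Finset.mem_univ (p ⟨0, hd⟩))
    rw [h2 ⟨0, hd⟩ p] at h3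
    simpa using h3

theorem not_isIntegralPolytope : ¬ IsIntegralPolytope (stochasticMagicPolytope 4 3) := by
  intro h
  have hne : (stochasticMagicPolytope 4 3).Nonempty :=
    ⟨fun _ => 1 / 3, fun _ => by norm_num, fun _ _ => by simp, fun _ => by simp⟩
  obtain ⟨v, hv⟩ := (isCompact_stochasticMagicPolytope (by norm_num)).extremePoints_nonempty hne
  obtain ⟨z, hz⟩ := h v hv ![1, 1, 1, 1]
  rw [centre_eq_third hv.1] at hz
  have h3 : (3 * z : ℝ) = 1 := by linarith
  have h4 : 3 * z = 1 := by exact_mod_cast h3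
  omega

end MagicCube

theorem theorem0p2 :
    (∀ n : ℕ, 3 ≤ n → n ≠ 4 →
      IsQuasipolynomialOfDegree (fun s => (MC n s : ℂ)) ((n - 1) ^ 3 - 4)) ∧
    IsQuasipolynomialOfDegree (fun s => (MC 4 s : ℂ)) 24 ∧
    PowerSeries.mk (fun s => (MC 3 s : ℚ)) =
      ((PowerSeries.X : PowerSeries ℚ) ^ 12 + 14 * PowerSeries.X ^ 9 + 36 * PowerSeries.X ^ 6
        + 14 * PowerSeries.X ^ 3 + 1) * ((1 - PowerSeries.X ^ 3) ^ 5)⁻¹ ∧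
    (MC 3 0 = 1 ∧ MC 3 3 = 19 ∧ MC 3 6 = 121 ∧ MC 3 9 = 439 ∧ MC 3 12 = 1171 ∧
      MC 3 15 = 2581 ∧ MC 3 18 = 4999) ∧
    (∀ s : ℕ, (MC 3 s : ℚ) =
      if 3 ∣ s then
        11 / 324 * (s : ℚ) ^ 4 + 11 / 54 * (s : ℚ) ^ 3 + 25 / 36 * (s : ℚ) ^ 2
          + 7 / 6 * (s : ℚ) + 1
      else 0) ∧
    ¬ IsIntegralPolytope (stochasticMagicPolytope 4 3) := by
  refine ⟨fun n hn hn4 => ?_, ?_, MagicCube.mk_MC_three, ?_, MagicCube.MC_three_eq,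
    MagicCube.not_isIntegralPolytope⟩
  · obtain ⟨m, rfl⟩ := Nat.exists_eq_add_of_le' hn
    have h := MagicCube.isQuasipolynomialOfDegree_MC (n := m + 3) (by omega)
    rwa [MagicCube.finrank_zeroLineSums_magicLine (by omega)] at h
  · have h := MagicCube.isQuasipolynomialOfDegree_MC (n := 4) (by omega)
    rwa [MagicCube.finrank_zeroLineSums_magicLine_four] at h
  · have h := MagicCube.four_mul_MC_three
    have h0 := h 0
    have h1 := h 1
    have h2 := h 2
    have h3 := h 3
    have h4 := h 4
    have h5 := h 5
    have h6 := h 6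
    norm_num at h0 h1 h2 h3 h4 h5 h6
    omega
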